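/- **Setting.** Let $n,m,p,h,k\in\mathbb N$ and $N\in\mathbb N\cup\{\infty\}$. An affine plant $\bar x_{j+1}=\bar A\bar x_j+\bar Bu_j+\bar c$, $\bar y_j=\bar C\bar x_j+\bar d$ (states in $\mathbb R^n$, inputs in $\mathbb R^m$, outputs in $\mathbb R^p$) is written in lifted form $x_{j+1}=Ax_j+Bu_j$, $y_j=Cx_j$ with $x_j=(\bar x_j,1)$, $y_j=(\bar y_j,1)$; affine maps are identified with their lifted matrices. A *quadruple* $\Omega=(\Sigma,J,D,\{x_j,u_j,y_j\}_{j\in\mathbb N})$ consists of a plant $\Sigma=(A,B,C)$, a cost $J(x,u)=\sum_{i=0}^N\Delta\eta_i^TM\Delta\eta_i$ with $\Delta\eta_i=(x_i-x_i^*,u_i-u_i^*)$, given by a matrix $M$ and references $x^*,u^*$, a matrix $D\in\mathbb R^{h\times(n+1+m)}$, and sequences $x,u,y$. Call $\Omega$ *optimal* if $(\bar A,\bar B)$ is controllable, $\ker\bar B=\{0\}$, $\operatorname{Im}\bar C=\mathbb R^p$, $M$ is positive definite, and $\{x_j,u_j,y_j\}$ is a trajectory of $\Sigma$ that satisfies $D(x_i,u_i)\le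 0$ for $0\le i\le N$, has finite cost, and minimizes $J$ among all trajectories with the same initial state that satisfy these constraints. Call it *admissible* if moreover $(\bar C,\bar A)$ is observable. Let $\mathcal G=\mathcal G_{n,m,p}$ be the Lie group of isomorphisms $\psi=(P,F,G,S)$, with $P$ and $S$ invertible affine maps of $\mathbb R^n$ and $\mathbb R^p$, $F:\mathbb R^n\to\mathbb R^m$ affine, $G\in GL(m,\mathbb R)$. With $L=\begin{bmatrix}P&0\\F&G\end{bmatrix}$, it acts on quadruples by $$\psi_*(A,B,C)=(P(A-BG^{-1}F)P^{-1},\,PBG^{-1},\,SCP^{-1}),\qquad M\mapsto L^{-T}ML^{-1},\qquad D\mapsto DL^{-1},$$ $(x^*,u^*)\mapsto L(x^*,u^*)$, $(x,u)\mapsto L(x,u)$, $y\mapsto Sy$. The protocol run on $\Omega$ with key $\psi$ exchanges the messages $\psi_*\Sigma$, $\psi_*J$, $\psi_*D$, $\{Sy_j\}_j$, $\{Fx_j+Gu_j\}_j$. Two quadruples are *indistinguishable* if for suitable keys the protocol exchanges the same messages for both. **Proposition.** Let $\Omega$ be an admissible quadruple such that $n+1$ rows of $D$ have zero input part and linearly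 independent state parts in $\mathbb R^{n+1}$. Let $\rho:\mathcal G\to\mathbb R^k$ be a smooth surjective map of constant rank $k$, let $l\in\mathbb R^k$, and let $\mathcal U=\{\psi_*\Omega:\psi\in\mathcal G,\ \rho(\psi)=l\}$ be the uncertainty set when any isomorphism may serve as key and the cloud knows $\rho(\psi)=l$. Then: 1. The stabilizer $\{\psi\in\mathcal G:\psi_*\Omega=\Omega\}$ consists of the identity $(I,0,I,I)$ only. 2. Every element of $\mathcal U$ is an optimal quadruple. 3. For every $\Omega'\in\mathcal U$ there are keys $\psi,\psi'\in\mathcal G$ with $\rho(\psi)=l$ such that the protocol exchanges the same messages for $\Omega$ with key $\psi$ and for $\Omega'$ with key $\psi'$; moreover any two elements of $\mathcal U\cup\{\Omega\}$ are indistinguishable. 4. $\dim\mathcal G=n(n+1)+m(n+1)+m^2+p(p+1)$, and $\mathcal U$ is an immersed submanifold of dimension $$\dim\mathcal G-k=n(n+1)+m(n+1)+m^2+p(p+1)-k .$$ Here this means: $\mathcal U$ is the image of a Hausdorff, second countable smooth manifold $W$ of that dimension under a map whose component $(A,B,C,M,D)$ is an injective smooth immersion into the space of matrices and whose components $x^*_i,u^*_i$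 ($0\le i\le N$) and $x_j,u_j,y_j$ ($j\in\mathbb N$) are smooth. -/

import Mathlib

open scoped Manifold ContDiff Matrix ENNReal

/-! ### Lifted coordinates -/

/-- Index set of the lifted vector `(v, 1)` with `v ∈ ℝⁿ`. -/
abbrev Lift (n : ℕ) : Type := Fin n ⊕ Unit

/-- Index set of `η = (x, u)`, where `x` is the lifted state and `u` the input. -/
abbrev StIn (n m : ℕ) : Type := Lift n ⊕ Fin m

/-- The times `0, …, N` of the control objective, with `N ∈ ℕ ∪ {∞}`. -/
abbrev Horizon (N : ℕ∞) : Type := {i : ℕ // (i : ℕ∞) ≤ N}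

/-! ### The group of isomorphisms as an open subset of a vector space -/

/-- Parameters of `(P, F, G, S)`, in this order: linear part and translation of `P`; the lifted
matrix of the affine map `F`; `G`; linear part and translation of `S`. -/
abbrev KeySpace (n m p : ℕ) : Type :=
  (Fin n → Fin n → ℝ) × (Fin n → ℝ) × (Fin m → Lift n → ℝ) × (Fin m → Fin m → ℝ) ×
    (Fin p → Fin p → ℝ) × (Fin p → ℝ)

/-- The isomorphisms `ψ = (P, F, G, S)`: `P` and `S` are invertible affine maps, `F` is an affine
map, and `G` is an invertible linear map. As an open subset of a vector space this set carries its
usual smooth structure. -/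
def IsoGroup (n m p : ℕ) : TopologicalSpace.Opens (KeySpace n m p) where
  carrier := {v | (Matrix.of v.1).det ≠ 0 ∧ (Matrix.of v.2.2.2.1).det ≠ 0 ∧
    (Matrix.of v.2.2.2.2.1).det ≠ 0}
  is_open' := by
    have h1 : Continuous fun v : KeySpace n m p => (Matrix.of v.1).det :=
      Continuous.matrix_det (by exact continuous_fst)
    have h2 : Continuous fun v : KeySpace n m p => (Matrix.of v.2.2.2.1).det :=
      Continuous.matrix_det
        (by exact continuous_fst.comp (continuous_snd.comp (continuous_snd.comp continuous_snd)))
    have h3 : Continuous fun v : KeySpace n m p => (Matrix.of v.2.2.2.2.1).det :=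
      Continuous.matrix_det
        (by exact continuous_fst.comp (continuous_snd.comp
          (continuous_snd.comp (continuous_snd.comp continuous_snd))))
    exact (isOpen_ne_fun h1 continuous_const).inter
      ((isOpen_ne_fun h2 continuous_const).inter (isOpen_ne_fun h3 continuous_const))

/-- The lifted matrix of the affine map `P`. -/
def isoP {n m p : ℕ} (ψ : IsoGroup n m p) : Matrix (Lift n) (Lift n) ℝ :=
  Matrix.fromBlocks (Matrix.of ψ.1.1) (Matrix.replicateCol Unit ψ.1.2.1) 0 1

/-- The lifted matrix of the affine map `F`. -/
def isoF {n m p : ℕ} (ψ : IsoGroup n m p) : Matrix (Fin m) (Lift n) ℝ := Matrix.of ψ.1.2.2.1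

/-- The matrix of the linear map `G`. -/
def isoG {n m p : ℕ} (ψ : IsoGroup n m p) : Matrix (Fin m) (Fin m) ℝ := Matrix.of ψ.1.2.2.2.1

/-- The lifted matrix of the affine map `S`. -/
def isoS {n m p : ℕ} (ψ : IsoGroup n m p) : Matrix (Lift p) (Lift p) ℝ :=
  Matrix.fromBlocks (Matrix.of ψ.1.2.2.2.2.1) (Matrix.replicateCol Unit ψ.1.2.2.2.2.2) 0 1

/-- The matrix `L` with `(x̃, ũ) = L (x, u)`. -/
def isoL {n m p : ℕ} (ψ : IsoGroup n m p) : Matrix (StIn n m) (StIn n m) ℝ :=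
  Matrix.fromBlocks (isoP ψ) 0 (isoF ψ) (isoG ψ)

/-! ### Quadruples `Ω = (Σ, J, D, {x, u, y})` -/

/-- The data of a quadruple: the lifted plant `(A, B, C)`, the cost `J` given by `M` and the
reference sequences, the constraint matrix `D`, and the sequences `x`, `u`, `y`, where `x` and `y`
are lifted. -/
@[ext]
structure Quadruple (n m p h : ℕ) (N : ℕ∞) where
  A : Matrix (Lift n) (Lift n) ℝ
  B : Matrix (Lift n) (Fin m) ℝ
  C : Matrix (Lift p) (Lift n) ℝ
  M : Matrix (StIn n m) (StIn n m) ℝ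
  xref : Horizon N → Lift n → ℝ
  uref : Horizon N → Fin m → ℝ
  D : Matrix (Fin h) (StIn n m) ℝ
  x : ℕ → Lift n → ℝ
  u : ℕ → Fin m → ℝ
  y : ℕ → Lift p → ℝ

namespace Quadruple

variable {n m p h : ℕ} {N : ℕ∞}

/-- The matrix part `(A, B, C, M, D)` of a quadruple takes values in this vector space. -/
abbrev MatrixSpace (n m p h : ℕ) : Type :=
  (Lift n → Lift n → ℝ) × (Lift n → Fin m → ℝ) × (Lift p → Lift n → ℝ) ×
    (StIn n m → StIn n m → ℝ) × (Fin h → StIn n m → ℝ)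

/-- The matrix part of a quadruple. -/
def matrices (Ω : Quadruple n m p h N) : MatrixSpace n m p h :=
  (Ω.A, Ω.B, Ω.C, Ω.M, Ω.D)

/-- Linear part of the state map. -/
def linA (Ω : Quadruple n m p h N) : Matrix (Fin n) (Fin n) ℝ := Ω.A.toBlocks₁₁

/-- Linear part of the input map. -/
def linB (Ω : Quadruple n m p h N) : Matrix (Fin n) (Fin m) ℝ := Ω.B.toRows₁

/-- Linear part of the output map. -/
def linC (Ω : Quadruple n m p h N) : Matrix (Fin p) (Fin n) ℝ := Ω.C.toBlocks₁₁

/-- `(A, B, C)` is the lift of an affine plant. -/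
def IsLifted (Ω : Quadruple n m p h N) : Prop :=
  Ω.A.toBlocks₂₁ = 0 ∧ Ω.A.toBlocks₂₂ = 1 ∧ Ω.B.toRows₂ = 0 ∧
    Ω.C.toBlocks₂₁ = 0 ∧ Ω.C.toBlocks₂₂ = 1

/-- The controllability matrix `[B AB ⋯ Aⁿ⁻¹B]` has rank `n`. -/
def IsControllable (Ω : Quadruple n m p h N) : Prop :=
  (Matrix.of fun (i : Fin n) (j : Fin n × Fin m) =>
    (Ω.linA ^ (j.1 : ℕ) * Ω.linB) i j.2).rank = n

/-- The observability matrix with block rows `C, CA, …, CAⁿ⁻¹` has rank `n`. -/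
def IsObservable (Ω : Quadruple n m p h N) : Prop :=
  (Matrix.of fun (j : Fin n × Fin p) (i : Fin n) =>
    (Ω.linC * Ω.linA ^ (j.1 : ℕ)) j.2 i).rank = n

/-- `{x, u, y}` is a trajectory of the plant of `Ω`. -/
def IsTrajectory (Ω : Quadruple n m p h N) (x : ℕ → Lift n → ℝ) (u : ℕ → Fin m → ℝ)
    (y : ℕ → Lift p → ℝ) : Prop :=
  ∀ k, x k (Sum.inr ()) = 1 ∧ x (k + 1) = Ω.A *ᵥ x k + Ω.B *ᵥ u k ∧ y k = Ω.C *ᵥ x k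

/-- The sequences satisfy the constraints `D ηᵢ ≤ 0` for `i = 0, …, N`. -/
def IsFeasible (Ω : Quadruple n m p h N) (x : ℕ → Lift n → ℝ) (u : ℕ → Fin m → ℝ) : Prop :=
  ∀ i : Horizon N, Ω.D *ᵥ Sum.elim (x i) (u i) ≤ 0

/-- The deviation `Δηᵢ` from the reference. -/
def deviation (Ω : Quadruple n m p h N) (x : ℕ → Lift n → ℝ) (u : ℕ → Fin m → ℝ)
    (i : Horizon N) : StIn n m → ℝ :=
  Sum.elim (x i - Ω.xref i) (u i - Ω.uref i)

/-- The cost `∑ᵢ Δηᵢᵀ M Δηᵢ`; its terms are nonnegative when `M` is positive definite. -/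
noncomputable def cost (Ω : Quadruple n m p h N) (x : ℕ → Lift n → ℝ) (u : ℕ → Fin m → ℝ) :
    ℝ≥0∞ :=
  ∑' i : Horizon N, ENNReal.ofReal (Ω.deviation x u i ⬝ᵥ Ω.M *ᵥ Ω.deviation x u i)

/-- `Ω` consists of a controllable affine plant with injective input map and surjective output map,
a positive definite cost, constraints, and a trajectory that has finite cost and is optimal among
the feasible trajectories with the same initial state. -/
structure IsOptimal (Ω : Quadruple n m p h N) : Prop where
  lifted : Ω.IsLifted
  controllable : Ω.IsControllable
  injective_B : Function.Injective Ω.linB.mulVec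
  surjective_C : Function.Surjective Ω.linC.mulVec
  posDef : Ω.M.PosDef
  trajectory : Ω.IsTrajectory Ω.x Ω.u Ω.y
  feasible : Ω.IsFeasible Ω.x Ω.u
  finite : Ω.cost Ω.x Ω.u ≠ ⊤
  minimal : ∀ x' u' y', Ω.IsTrajectory x' u' y' → x' 0 = Ω.x 0 → Ω.IsFeasible x' u' →
    Ω.cost Ω.x Ω.u ≤ Ω.cost x' u'

/-- The quadruples whose plant is moreover observable. -/
structure IsAdmissible (Ω : Quadruple n m p h N) : Prop extends Ω.IsOptimal where
  observable : Ω.IsObservable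

/-- `n + 1` of the constraints involve the (lifted) state only and are linearly independent. -/
def HasStateConstraints (Ω : Quadruple n m p h N) : Prop :=
  ∃ r : Fin (n + 1) → Fin h, (∀ i j, Ω.D (r i) (Sum.inr j) = 0) ∧
    LinearIndependent ℝ fun i (j : Lift n) => Ω.D (r i) (Sum.inl j)

/-- The action `ψ_* Ω` of an isomorphism on a quadruple. -/
noncomputable def act (ψ : IsoGroup n m p) (Ω : Quadruple n m p h N) : Quadruple n m p h N where
  A := isoP ψ * (Ω.A - Ω.B * (isoG ψ)⁻¹ * isoF ψ) * (isoP ψ)⁻¹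
  B := isoP ψ * Ω.B * (isoG ψ)⁻¹
  C := isoS ψ * Ω.C * (isoP ψ)⁻¹
  M := (isoL ψ)⁻¹ᵀ * Ω.M * (isoL ψ)⁻¹
  xref := fun i => isoP ψ *ᵥ Ω.xref i
  uref := fun i => isoF ψ *ᵥ Ω.xref i + isoG ψ *ᵥ Ω.uref i
  D := Ω.D * (isoL ψ)⁻¹
  x := fun k => isoP ψ *ᵥ Ω.x k
  u := fun k => isoF ψ *ᵥ Ω.x k + isoG ψ *ᵥ Ω.u k
  y := fun k => isoS ψ *ᵥ Ω.y k

/-- `Θ_Ω(ρ⁻¹(l))`: all `ψ_* Ω` with `ρ(ψ) = l`. -/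
def uncertaintySet {E : Type*} (Ω : Quadruple n m p h N) (ρ : IsoGroup n m p → E) (l : E) :
    Set (Quadruple n m p h N) :=
  (fun ψ => act ψ Ω) '' (ρ ⁻¹' {l})

end Quadruple

/-! ### The protocol -/

/-- The messages exchanged between plant and cloud: plant, cost and constraints in the handshake;
outputs (to the cloud) and inputs (to the plant) during execution. -/
@[ext]
structure Transcript (n m p h : ℕ) (N : ℕ∞) where
  A : Matrix (Lift n) (Lift n) ℝ
  B : Matrix (Lift n) (Fin m) ℝ
  C : Matrix (Lift p) (Lift n) ℝ
  M : Matrix (StIn n m) (StIn n m) ℝ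
  xref : Horizon N → Lift n → ℝ
  uref : Horizon N → Fin m → ℝ
  D : Matrix (Fin h) (StIn n m) ℝ
  y : ℕ → Lift p → ℝ
  u : ℕ → Fin m → ℝ

namespace Quadruple

variable {n m p h : ℕ} {N : ℕ∞}

/-- The messages exchanged when the protocol is run on `Ω` with the key `ψ`. -/
noncomputable def messages (Ω : Quadruple n m p h N) (ψ : IsoGroup n m p) :
    Transcript n m p h N where
  A := (act ψ Ω).A
  B := (act ψ Ω).B
  C := (act ψ Ω).C
  M := (act ψ Ω).M
  xref := (act ψ Ω).xref
  uref := (act ψ Ω).uref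
  D := (act ψ Ω).D
  y := fun k => isoS ψ *ᵥ Ω.y k
  u := fun k => isoF ψ *ᵥ Ω.x k + isoG ψ *ᵥ Ω.u k

/-- The exchanged messages for `Ω` and for `Ω'` can be made the same by a choice of the keys. -/
def Indistinguishable (Ω Ω' : Quadruple n m p h N) : Prop :=
  ∃ ψ ψ' : IsoGroup n m p, Ω.messages ψ = Ω'.messages ψ'

/-! ### Immersed submanifolds -/

/-- `U` is the bijective image of a (Hausdorff, second countable) smooth `d`-manifold `W` under a
smooth map whose matrix part is an injective immersion. -/
def IsImmersedSubmanifold (d : ℕ) (U : Set (Quadruple n m p h N)) : Prop :=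
  ∃ (W : Type) (_ : TopologicalSpace W) (_ : ChartedSpace (EuclideanSpace ℝ (Fin d)) W)
    (f : W → Quadruple n m p h N),
    T2Space W ∧ SecondCountableTopology W ∧ IsManifold (𝓡 d) ∞ W ∧
    Set.range f = U ∧
    Function.Injective (fun w => (f w).matrices) ∧
    ContMDiff (𝓡 d) 𝓘(ℝ, MatrixSpace n m p h) ∞ (fun w => (f w).matrices) ∧
    (∀ w, Function.Injective
      (mfderiv (𝓡 d) 𝓘(ℝ, MatrixSpace n m p h) (fun w => (f w).matrices) w)) ∧
    (∀ i, ContMDiff (𝓡 d) 𝓘(ℝ, Lift n → ℝ) ∞ (fun w => (f w).xref i)) ∧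
    (∀ i, ContMDiff (𝓡 d) 𝓘(ℝ, Fin m → ℝ) ∞ (fun w => (f w).uref i)) ∧
    (∀ k, ContMDiff (𝓡 d) 𝓘(ℝ, Lift n → ℝ) ∞ (fun w => (f w).x k)) ∧
    (∀ k, ContMDiff (𝓡 d) 𝓘(ℝ, Fin m → ℝ) ∞ (fun w => (f w).u k)) ∧
    (∀ k, ContMDiff (𝓡 d) 𝓘(ℝ, Lift p → ℝ) ∞ (fun w => (f w).y k))

end Quadruple

/-! The orbit map `ψ ↦ act ψ Ω` is an injective immersion, and the uncertainty set is its image of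
the level set `ρ = l`. Constant rank `k` makes `ρ` a submersion, so this level set is a manifold of
dimension `dim 𝒢 - k`, which the orbit map carries to an immersed submanifold.

Both injectivity statements come from one linear computation. Without inverses, `Ω' = act ψ Ω` reads
`A'P + B'F = PA`, `B'G = PB`, `C'P = SC`, `D'L = D` (with similar relations for the cost and the
sequences); for fixed matrices `A`, `B`, `C` and `A'`, `B'`, `C'`, the first three are linear in
`(P, F, G, S)`. On the `n + 1` state rows, the last one becomes `E'P = E` with `E'` injective. The
homogeneous system has only the zero solution: `E'P = 0` forces `P = 0`, then injectivity of `B'`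
kills `F` and `G`, and surjectivity of `C` kills `S`. This is `IsOptimal.eq_zero_of_mul_eq`. Applied
to the difference of two keys with the same image it gives injectivity and the trivial stabilizer;
applied to a tangent vector in the kernel of the derivative it gives the immersion.

Optimality is invariant because trajectories, constraints and cost are transported bijectively by a
key and its inverse. Indistinguishability holds because every element of the uncertainty set can be
carried back to `Ω`, and the messages are components of the transformed quadruple. -/

/-! ### Level sets of submersions -/

section LevelSet

variable {V E : Type*} [NormedAddCommGroup V] [NormedAddCommGroup E]

/-- The chart induced on the level set `{v ∈ U | f v = l}` by coordinates in which `f` is a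
projection. -/
noncomputable def levelSetChart {f : V → E} {U : Set V} {l : E} {d : ℕ}
    (Φ : OpenPartialHomeomorph V (E × EuclideanSpace ℝ (Fin d))) (hΦU : Φ.source ⊆ U)
    (hΦ : ∀ v, (Φ v).1 = f v) (w₀ : {v // v ∈ U ∧ f v = l}) :
    OpenPartialHomeomorph {v // v ∈ U ∧ f v = l} (EuclideanSpace ℝ (Fin d)) := by
  classical
  have hmk : ∀ w : {v // v ∈ U ∧ f v = l}, (l, (Φ w).2) = Φ w := fun w =>
    Prod.ext (by rw [hΦ]; exact w.2.2.symm) rfl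
  have hmem : ∀ z, (l, z) ∈ Φ.target → Φ.symm (l, z) ∈ U ∧ f (Φ.symm (l, z)) = l := fun z hz =>
    ⟨hΦU (Φ.map_target hz), by rw [← hΦ, Φ.right_inv hz]⟩
  exact
  { toFun := fun w => (Φ w).2
    -- Off the target the value `w₀` is arbitrary; it only makes the inverse a total function.
    invFun := fun z => if hz : (l, z) ∈ Φ.target then ⟨Φ.symm (l, z), hmem z hz⟩ else w₀
    source := {w | (w : V) ∈ Φ.source}
    target := {z | (l, z) ∈ Φ.target}
    map_source' := fun w hw => by
      simp only [Set.mem_ofPred_eq, hmk] at hw ⊢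
      exact Φ.map_source hw
    map_target' := fun z hz => by
      simp only [Set.mem_ofPred_eq] at hz ⊢
      rw [dif_pos hz]
      exact Φ.map_target hz
    left_inv' := fun w hw => by
      simp only [Set.mem_ofPred_eq, hmk] at hw ⊢
      rw [dif_pos (Φ.map_source hw)]
      exact Subtype.ext (Φ.left_inv hw)
    right_inv' := fun z hz => by
      simp only [Set.mem_ofPred_eq] at hz ⊢
      rw [dif_pos hz]
      exact congrArg Prod.snd (Φ.right_inv hz)
    open_source := Φ.open_source.preimage continuous_subtype_val
    open_target := Φ.open_target.preimage (by fun_prop)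
    continuousOn_toFun := continuous_snd.comp_continuousOn
      (Φ.continuousOn.comp continuous_subtype_val.continuousOn fun w hw => hw)
    continuousOn_invFun := by
      have hind : Topology.IsInducing (Subtype.val : {v // v ∈ U ∧ f v = l} → V) := ⟨rfl⟩
      rw [hind.continuousOn_iff]
      refine (Φ.continuousOn_symm.comp (f := fun z => (l, z)) (by fun_prop)
        fun z hz => hz).congr fun z hz => ?_
      have hz' : (l, z) ∈ Φ.target := hz
      simp only [Function.comp_apply]
      rw [dif_pos hz'] }

theorem coe_levelSetChart_symm {f : V → E} {U : Set V} {l : E} {d : ℕ}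
    (Φ : OpenPartialHomeomorph V (E × EuclideanSpace ℝ (Fin d))) (hΦU : Φ.source ⊆ U)
    (hΦ : ∀ v, (Φ v).1 = f v) (w₀ : {v // v ∈ U ∧ f v = l}) {z : EuclideanSpace ℝ (Fin d)}
    (hz : z ∈ (levelSetChart Φ hΦU hΦ w₀).target) :
    ((levelSetChart Φ hΦU hΦ w₀).symm z : V) = Φ.symm (l, z) := by
  have hz' : (l, z) ∈ Φ.target := hz
  simp [levelSetChart, hz']

variable [NormedSpace ℝ V] [FiniteDimensional ℝ V] [NormedSpace ℝ E] [FiniteDimensional ℝ E]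

/-- A submersion is, in suitable local coordinates, the projection onto a factor. -/
theorem exists_submersion_coordinates {f : V → E} {U : Set V} (hU : IsOpen U)
    (hf : ContDiffOn ℝ ∞ f U) {v₀ : V} (hv₀ : v₀ ∈ U)
    (hsurj : Function.Surjective (fderiv ℝ f v₀)) {d : ℕ}
    (hd : d + Module.finrank ℝ E = Module.finrank ℝ V) :
    ∃ Φ : OpenPartialHomeomorph V (E × EuclideanSpace ℝ (Fin d)),
      v₀ ∈ Φ.source ∧ Φ.source ⊆ U ∧ (∀ v, (Φ v).1 = f v) ∧
      ContDiffOn ℝ ∞ Φ Φ.source ∧ ContDiffOn ℝ ∞ Φ.symm Φ.target := by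
  have hker : Module.finrank ℝ (LinearMap.ker (fderiv ℝ f v₀).toLinearMap)
      = Module.finrank ℝ (EuclideanSpace ℝ (Fin d)) := by
    have h1 := (fderiv ℝ f v₀).toLinearMap.finrank_range_add_finrank_ker
    rw [LinearMap.range_eq_top.2 hsurj, finrank_top] at h1
    rw [finrank_euclideanSpace_fin]
    omega
  -- A projection onto the kernel of the derivative, identified with `ℝᵈ`, supplies the missing
  -- coordinates: together with the derivative of `f` it is an isomorphism, so the inverse function
  -- theorem applies to `(f, π)`.
  obtain ⟨g, hg⟩ := LinearMap.exists_leftInverse_of_injective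
    (LinearMap.ker (fderiv ℝ f v₀).toLinearMap).subtype (Submodule.ker_subtype _)
  let π : V →L[ℝ] EuclideanSpace ℝ (Fin d) :=
    LinearMap.toContinuousLinearMap ((LinearEquiv.ofFinrankEq _ _ hker).toLinearMap ∘ₗ g)
  have hinj : Function.Injective ((fderiv ℝ f v₀).prod π) := by
    rw [injective_iff_map_eq_zero]
    intro v hv
    have h1 : fderiv ℝ f v₀ v = 0 := congrArg Prod.fst hv
    have h2 : (LinearEquiv.ofFinrankEq _ _ hker) (g v) = 0 := congrArg Prod.snd hv
    have h3 : g v = 0 := by simpa using h2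
    have h4 := LinearMap.congr_fun hg ⟨v, h1⟩
    simp only [LinearMap.comp_apply, Submodule.subtype_apply, LinearMap.id_apply] at h4
    rw [h3] at h4
    exact congrArg Subtype.val h4.symm
  let e : V ≃L[ℝ] E × EuclideanSpace ℝ (Fin d) :=
    (LinearMap.linearEquivOfInjective ((fderiv ℝ f v₀).prod π).toLinearMap hinj (by
      rw [Module.finrank_prod, finrank_euclideanSpace_fin]; omega)).toContinuousLinearEquiv
  have he : (e : V →L[ℝ] E × EuclideanSpace ℝ (Fin d)) = (fderiv ℝ f v₀).prod π := by
    ext v <;> rfl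
  have hΨ : ContDiffOn ℝ ∞ (fun v => (f v, π v)) U := hf.prodMk π.contDiff.contDiffOn
  have hdiff : ∀ v ∈ U, DifferentiableAt ℝ (fun v => (f v, π v)) v := fun v hv =>
    (hΨ.contDiffAt (hU.mem_nhds hv)).differentiableAt (by simp)
  have hder : HasFDerivAt (fun v => (f v, π v)) (e : V →L[ℝ] _) v₀ := by
    rw [he]
    exact ((hf.contDiffAt (hU.mem_nhds hv₀)).differentiableAt (by simp)).hasFDerivAt.prodMk
      π.hasFDerivAt
  -- Restricting to the open set where the derivative of `(f, π)` stays invertible makes the local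
  -- inverse smooth on its whole target, not only near the image of `v₀`.
  have hO : IsOpen (U ∩ fderiv ℝ (fun v => (f v, π v)) ⁻¹'
      Set.range ((↑) : (V ≃L[ℝ] E × EuclideanSpace ℝ (Fin d)) → V →L[ℝ] _)) :=
    (hΨ.continuousOn_fderiv_of_isOpen hU (by simp)).isOpen_inter_preimage hU
      (ContinuousLinearEquiv.isOpen)
  have hc := hΨ.contDiffAt (hU.mem_nhds hv₀)
  have hsub : ∀ v ∈ ((hc.toOpenPartialHomeomorph _ hder (by simp)).restrOpen _ hO).source,
      v ∈ U ∧ ∃ e' : V ≃L[ℝ] E × EuclideanSpace ℝ (Fin d),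
        (e' : V →L[ℝ] _) = fderiv ℝ (fun v => (f v, π v)) v := by
    intro v hv
    rw [OpenPartialHomeomorph.restrOpen_source] at hv
    exact hv.2
  refine ⟨(hc.toOpenPartialHomeomorph _ hder (by simp)).restrOpen _ hO, ?_, fun v hv =>
    (hsub v hv).1, fun v => rfl, ?_, ?_⟩
  · rw [OpenPartialHomeomorph.restrOpen_source]
    exact ⟨hc.mem_toOpenPartialHomeomorph_source hder (by simp), hv₀, e, hder.fderiv.symm⟩
  · exact hΨ.mono fun v hv => (hsub v hv).1
  · intro z hz
    obtain ⟨h1, e', he'⟩ := hsub _ (OpenPartialHomeomorph.map_target _ hz)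
    refine (OpenPartialHomeomorph.contDiffAt_symm _ hz (f₀' := e') ?_ ?_).contDiffWithinAt
    · rw [he']
      exact (hdiff _ h1).hasFDerivAt
    · exact hΨ.contDiffAt (hU.mem_nhds h1)

/-- A level set of a submersion is a manifold whose inclusion is a smooth immersion. -/
theorem exists_manifold_levelSet {f : V → E} {U : Set V} (hU : IsOpen U)
    (hf : ContDiffOn ℝ ∞ f U) (l : E)
    (hsurj : ∀ v ∈ U, f v = l → Function.Surjective (fderiv ℝ f v)) {d : ℕ}
    (hd : d + Module.finrank ℝ E = Module.finrank ℝ V) :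
    ∃ _ : ChartedSpace (EuclideanSpace ℝ (Fin d)) {v // v ∈ U ∧ f v = l},
      IsManifold (𝓡 d) ∞ {v // v ∈ U ∧ f v = l} ∧
      ContMDiff (𝓡 d) 𝓘(ℝ, V) ∞ (Subtype.val : {v // v ∈ U ∧ f v = l} → V) ∧
      ∀ w, Function.Injective
        (mfderiv (𝓡 d) 𝓘(ℝ, V) (Subtype.val : {v // v ∈ U ∧ f v = l} → V) w) := by
  choose Φ h₀ hΦU hΦ hsm hsm' using fun w : {v // v ∈ U ∧ f v = l} =>
    exists_submersion_coordinates hU hf w.2.1 (hsurj _ w.2.1 w.2.2) hd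
  let ch : {v // v ∈ U ∧ f v = l} → OpenPartialHomeomorph {v // v ∈ U ∧ f v = l}
    (EuclideanSpace ℝ (Fin d)) := fun w => levelSetChart (Φ w) (hΦU w) (hΦ w) w
  let inst : ChartedSpace (EuclideanSpace ℝ (Fin d)) {v // v ∈ U ∧ f v = l} :=
    { atlas := Set.range ch
      chartAt := ch
      mem_chart_source := h₀
      chart_mem_atlas := fun w => ⟨w, rfl⟩ }
  have hsymm : ∀ w, ContDiffOn ℝ ∞ (fun z => ((ch w).symm z : V)) (ch w).target := fun w =>
    ((hsm' w).comp (f := fun z => (l, z)) (contDiff_const.prodMk contDiff_id).contDiffOn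
      fun z hz => hz).congr fun z hz => coe_levelSetChart_symm _ _ _ _ hz
  have hman : IsManifold (𝓡 d) ∞ {v // v ∈ U ∧ f v = l} := by
    refine isManifold_of_contDiffOn _ _ _ ?_
    rintro _ _ ⟨w, rfl⟩ ⟨w', rfl⟩
    -- A transition map factors through `V`: a smooth inverse chart followed by the second component
    -- of `Φ w'`.
    have h1 : ContDiffOn ℝ ∞ (ch w' ∘ (ch w).symm)
        ((ch w).symm ≫ₕ ch w').source := by
      rw [OpenPartialHomeomorph.trans_source]
      exact contDiff_snd.comp_contDiffOn
        ((hsm w').comp ((hsymm w).mono Set.inter_subset_left) fun z hz => hz.2)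
    simpa using h1
  have hval : ∀ w, ContMDiffOn (𝓡 d) 𝓘(ℝ, V) ∞
      (Subtype.val : {v // v ∈ U ∧ f v = l} → V) (ch w).source := by
    intro w
    have h1 : ContMDiffOn (𝓡 d) (𝓡 d) ∞ (ch w) (ch w).source := contMDiffOn_chart (x := w)
    refine ((hsymm w).contMDiffOn.comp h1 fun z hz => (ch w).map_source hz).congr fun z hz => ?_
    exact congrArg Subtype.val ((ch w).left_inv hz).symm
  have hval' : ContMDiff (𝓡 d) 𝓘(ℝ, V) ∞ (Subtype.val : {v // v ∈ U ∧ f v = l} → V) := fun w =>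
    (hval w).contMDiffAt ((ch w).open_source.mem_nhds (h₀ w))
  refine ⟨inst, hman, hval', fun w => ?_⟩
  -- The chart at `w` is the inclusion followed by a map that is smooth on a neighbourhood in `V`.
  -- Its derivative is invertible, so the derivative of the inclusion, applied first, is injective.
  have hΦd : MDifferentiableAt 𝓘(ℝ, V) (𝓡 d) (fun v => (Φ w v).2) w :=
    (contDiff_snd.contDiffAt.comp _ ((hsm w).contDiffAt ((Φ w).open_source.mem_nhds
      (h₀ w)))).contMDiffAt.mdifferentiableAt (by simp)
  have hcomp := mfderiv_comp w hΦd (hval'.mdifferentiableAt (by simp))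
  have hinv := (isInvertible_mfderiv_extChartAt (I := 𝓡 d) (mem_extChartAt_source w)).injective
  have heq : (extChartAt (𝓡 d) w : _ → EuclideanSpace ℝ (Fin d))
    = (fun v => (Φ w v).2) ∘ Subtype.val := rfl
  rw [heq, hcomp] at hinv
  exact Function.Injective.of_comp hinv

end LevelSet

/-! ### The isomorphisms as matrices -/

section Isomorphism

variable {n m p : ℕ}

theorem isUnit_isoP (ψ : IsoGroup n m p) : IsUnit (isoP ψ) := by
  rw [Matrix.isUnit_iff_isUnit_det, isoP, Matrix.det_fromBlocks_zero₂₁, Matrix.det_one, mul_one]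
  exact isUnit_iff_ne_zero.2 ψ.2.1

theorem isUnit_isoG (ψ : IsoGroup n m p) : IsUnit (isoG ψ) := by
  rw [Matrix.isUnit_iff_isUnit_det]
  exact isUnit_iff_ne_zero.2 ψ.2.2.1

theorem isUnit_isoL (ψ : IsoGroup n m p) : IsUnit (isoL ψ) := by
  rw [Matrix.isUnit_iff_isUnit_det, isoL, Matrix.det_fromBlocks_zero₁₂]
  exact ((Matrix.isUnit_iff_isUnit_det _).1 (isUnit_isoP ψ)).mul
    ((Matrix.isUnit_iff_isUnit_det _).1 (isUnit_isoG ψ))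

theorem isoP_inr (ψ : IsoGroup n m p) : isoP ψ (Sum.inr ()) = Pi.single (Sum.inr ()) 1 := by
  ext j
  rcases j with j | j <;> simp [isoP]

theorem isoS_inr (ψ : IsoGroup n m p) : isoS ψ (Sum.inr ()) = Pi.single (Sum.inr ()) 1 := by
  ext j
  rcases j with j | j <;> simp [isoS]

theorem affine_left_inv {q : ℕ} {X : Matrix (Fin q) (Fin q) ℝ} (hX : X.det ≠ 0)
    (b : Fin q → ℝ) :
    Matrix.fromBlocks X⁻¹ (Matrix.replicateCol Unit (-(X⁻¹ *ᵥ b))) 0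
      (1 : Matrix Unit Unit ℝ) * Matrix.fromBlocks X (Matrix.replicateCol Unit b) 0 1 = 1 := by
  rw [Matrix.fromBlocks_multiply, ← Matrix.fromBlocks_one]
  congr 1
  · simp [Matrix.nonsing_inv_mul _ (isUnit_iff_ne_zero.2 hX)]
  · ext i j
    simp [Matrix.mul_apply, Matrix.mulVec, dotProduct]
  · simp
  · simp

/-- The isomorphism with the given components. -/
def isoMk (P : Matrix (Fin n) (Fin n) ℝ) (b : Fin n → ℝ) (F : Matrix (Fin m) (Lift n) ℝ)
    (G : Matrix (Fin m) (Fin m) ℝ) (S : Matrix (Fin p) (Fin p) ℝ) (c : Fin p → ℝ)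
    (hP : P.det ≠ 0) (hG : G.det ≠ 0) (hS : S.det ≠ 0) : IsoGroup n m p :=
  ⟨(P, b, F, G, S, c), hP, hG, hS⟩

/-- `φ` is a left inverse of `ψ` for the composition of isomorphisms. -/
structure IsIsoInverse (φ ψ : IsoGroup n m p) : Prop where
  P : isoP φ * isoP ψ = 1
  G : isoG φ * isoG ψ = 1
  F : isoF φ * isoP ψ + isoG φ * isoF ψ = 0
  S : isoS φ * isoS ψ = 1

theorem exists_isIsoInverse (ψ : IsoGroup n m p) : ∃ φ, IsIsoInverse φ ψ := by
  have hP := Matrix.nonsing_inv_mul _ ((Matrix.isUnit_iff_isUnit_det _).1 (isUnit_isoP ψ))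
  have hG := Matrix.nonsing_inv_mul _ ((Matrix.isUnit_iff_isUnit_det _).1 (isUnit_isoG ψ))
  have hinv : ∀ {q : ℕ} {X : Matrix (Fin q) (Fin q) ℝ}, X.det ≠ 0 → X⁻¹.det ≠ 0 :=
    fun {q X} hX => by
      rw [Matrix.det_nonsing_inv, Ring.inverse_eq_inv']
      exact inv_ne_zero hX
  -- The translations are those of the inverse affine maps; the feedback component is forced by the
  -- vanishing lower left block of the product of the `L` matrices.
  refine ⟨isoMk (Matrix.of ψ.1.1)⁻¹ (-((Matrix.of ψ.1.1)⁻¹ *ᵥ ψ.1.2.1))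
    (-((isoG ψ)⁻¹ * isoF ψ * (isoP ψ)⁻¹)) (isoG ψ)⁻¹ (Matrix.of ψ.1.2.2.2.2.1)⁻¹
    (-((Matrix.of ψ.1.2.2.2.2.1)⁻¹ *ᵥ ψ.1.2.2.2.2.2)) (hinv ψ.2.1) (hinv ψ.2.2.1)
    (hinv ψ.2.2.2), ?_, ?_, ?_, ?_⟩
  · exact affine_left_inv ψ.2.1 _
  · exact hG
  · change (-((isoG ψ)⁻¹ * isoF ψ * (isoP ψ)⁻¹)) * isoP ψ + (isoG ψ)⁻¹ * isoF ψ = 0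
    rw [Matrix.neg_mul, Matrix.mul_assoc, hP, Matrix.mul_one, neg_add_cancel]
  · exact affine_left_inv ψ.2.2.2 _

theorem IsIsoInverse.mul_isoL {φ ψ : IsoGroup n m p} (hφ : IsIsoInverse φ ψ) :
    isoL φ * isoL ψ = 1 := by
  rw [isoL, isoL, Matrix.fromBlocks_multiply, ← Matrix.fromBlocks_one]
  congr 1
  · rw [hφ.P, Matrix.zero_mul, add_zero]
  · simp
  · exact hφ.F
  · simp [hφ.G]

end Isomorphism

namespace Quadruple

variable {n m p h : ℕ} {N : ℕ∞}

/-! ### The action as a relation -/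

/-- `Ω' = ψ_* Ω`, expressed without inverse matrices. -/
structure ActRel (ψ : IsoGroup n m p) (Ω Ω' : Quadruple n m p h N) : Prop where
  A : Ω'.A * isoP ψ + Ω'.B * isoF ψ = isoP ψ * Ω.A
  B : Ω'.B * isoG ψ = isoP ψ * Ω.B
  C : Ω'.C * isoP ψ = isoS ψ * Ω.C
  M : (isoL ψ)ᵀ * Ω'.M * isoL ψ = Ω.M
  D : Ω'.D * isoL ψ = Ω.D
  xref : ∀ i, Ω'.xref i = isoP ψ *ᵥ Ω.xref i
  uref : ∀ i, Ω'.uref i = isoF ψ *ᵥ Ω.xref i + isoG ψ *ᵥ Ω.uref i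
  x : ∀ k, Ω'.x k = isoP ψ *ᵥ Ω.x k
  u : ∀ k, Ω'.u k = isoF ψ *ᵥ Ω.x k + isoG ψ *ᵥ Ω.u k
  y : ∀ k, Ω'.y k = isoS ψ *ᵥ Ω.y k

theorem actRel_act (ψ : IsoGroup n m p) (Ω : Quadruple n m p h N) : ActRel ψ Ω (act ψ Ω) := by
  have hP := Matrix.nonsing_inv_mul _ ((Matrix.isUnit_iff_isUnit_det _).1 (isUnit_isoP ψ))
  have hG := Matrix.nonsing_inv_mul _ ((Matrix.isUnit_iff_isUnit_det _).1 (isUnit_isoG ψ))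
  have hL := Matrix.nonsing_inv_mul _ ((Matrix.isUnit_iff_isUnit_det _).1 (isUnit_isoL ψ))
  constructor
  · simp only [act, Matrix.mul_assoc, hP, Matrix.mul_one, Matrix.mul_sub, sub_add_cancel]
  · simp only [act, Matrix.mul_assoc, hG, Matrix.mul_one]
  · simp only [act, Matrix.mul_assoc, hP, Matrix.mul_one]
  · simp only [act, Matrix.mul_assoc, hL, Matrix.mul_one]
    rw [← Matrix.mul_assoc, ← Matrix.transpose_mul, hL, Matrix.transpose_one, Matrix.one_mul]
  · simp only [act, Matrix.mul_assoc, hL, Matrix.mul_one]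
  all_goals exact fun _ => rfl

theorem ActRel.eq_act {ψ : IsoGroup n m p} {Ω Ω' : Quadruple n m p h N} (hr : ActRel ψ Ω Ω') :
    Ω' = act ψ Ω := by
  have hP := (Matrix.isUnit_iff_isUnit_det _).1 (isUnit_isoP ψ)
  have hG := (Matrix.isUnit_iff_isUnit_det _).1 (isUnit_isoG ψ)
  have hL := (Matrix.isUnit_iff_isUnit_det _).1 (isUnit_isoL ψ)
  have hL' : IsUnit (isoL ψ)ᵀ.det := by rwa [Matrix.det_transpose]
  have hB : Ω'.B = isoP ψ * Ω.B * (isoG ψ)⁻¹ := by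
    rw [← hr.B, Matrix.mul_nonsing_inv_cancel_right _ _ hG]
  ext1
  · have h1 : Ω'.A * isoP ψ = isoP ψ * (Ω.A - Ω.B * (isoG ψ)⁻¹ * isoF ψ) := by
      rw [Matrix.mul_sub, ← hr.A, hB]
      simp only [Matrix.mul_assoc, add_sub_cancel_right]
    rw [act, ← h1, Matrix.mul_nonsing_inv_cancel_right _ _ hP]
  · exact hB
  · rw [act, ← hr.C, Matrix.mul_nonsing_inv_cancel_right _ _ hP]
  · change _ = (isoL ψ)⁻¹ᵀ * Ω.M * (isoL ψ)⁻¹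
    rw [← hr.M, Matrix.transpose_nonsing_inv, ← Matrix.mul_assoc,
      Matrix.mul_nonsing_inv_cancel_right _ _ hL, Matrix.nonsing_inv_mul_cancel_left _ _ hL']
  · exact funext hr.xref
  · exact funext hr.uref
  · rw [act, ← hr.D, Matrix.mul_nonsing_inv_cancel_right _ _ hL]
  · exact funext hr.x
  · exact funext hr.u
  · exact funext hr.y

/-- Reversibility serves twice: it pulls competing trajectories back to `Ω`, and it returns elements
of the orbit to `Ω`. -/
theorem ActRel.symm {φ ψ : IsoGroup n m p} (hφ : IsIsoInverse φ ψ) {Ω Ω' : Quadruple n m p h N}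
    (hr : ActRel ψ Ω Ω') : ActRel φ Ω' Ω := by
  have hP := mul_eq_one_comm.1 hφ.P
  have hG := mul_eq_one_comm.1 hφ.G
  have hL := mul_eq_one_comm.1 hφ.mul_isoL
  have hF : isoF φ = -(isoG φ * isoF ψ * isoP φ) := by
    have h1 := congrArg (· * isoP φ) hφ.F
    simp only [Matrix.add_mul, Matrix.mul_assoc, hP, Matrix.mul_one, Matrix.zero_mul] at h1
    rw [Matrix.mul_assoc]
    exact eq_neg_of_add_eq_zero_left h1
  have hB : Ω.B * isoG φ = isoP φ * Ω'.B := by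
    have h1 := congrArg (fun X => isoP φ * X * isoG φ) hr.B
    simp only [Matrix.mul_assoc, hG, Matrix.mul_one] at h1
    rw [h1, ← Matrix.mul_assoc, hφ.P, Matrix.one_mul]
  have hx : ∀ x : Lift n → ℝ, x = isoP φ *ᵥ isoP ψ *ᵥ x := fun x => by
    rw [Matrix.mulVec_mulVec, hφ.P, Matrix.one_mulVec]
  have hu : ∀ (x : Lift n → ℝ) (u : Fin m → ℝ),
      u = isoF φ *ᵥ isoP ψ *ᵥ x + isoG φ *ᵥ (isoF ψ *ᵥ x + isoG ψ *ᵥ u) := fun x u => by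
    rw [Matrix.mulVec_add, Matrix.mulVec_mulVec, Matrix.mulVec_mulVec, Matrix.mulVec_mulVec,
      ← add_assoc, ← Matrix.add_mulVec, hφ.F, hφ.G, Matrix.zero_mulVec, Matrix.one_mulVec, zero_add]
  constructor
  · have h1 := congrArg (fun X => isoP φ * X * isoP φ) hr.A
    simp only [Matrix.mul_add, Matrix.add_mul, Matrix.mul_assoc, hP, Matrix.mul_one] at h1
    rw [← Matrix.mul_assoc (isoP φ) (isoP ψ), hφ.P, Matrix.one_mul,
      ← Matrix.mul_assoc (isoP φ) Ω'.B, ← hB] at h1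
    rw [← h1, hF]
    simp [Matrix.mul_assoc]
  · exact hB
  · have h1 := congrArg (fun X => isoS φ * X * isoP φ) hr.C
    simp only [Matrix.mul_assoc, hP, Matrix.mul_one] at h1
    rw [h1, ← Matrix.mul_assoc, hφ.S, Matrix.one_mul]
  · rw [← hr.M, Matrix.mul_assoc, Matrix.mul_assoc, hL, Matrix.mul_one, ← Matrix.mul_assoc,
      ← Matrix.transpose_mul, hL, Matrix.transpose_one, Matrix.one_mul]
  · rw [← hr.D, Matrix.mul_assoc, hL, Matrix.mul_one]
  · intro i
    rw [hr.xref, ← hx]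
  · intro i
    rw [hr.xref, hr.uref, ← hu]
  · intro i
    rw [hr.x, ← hx]
  · intro i
    rw [hr.x, hr.u, ← hu]
  · intro i
    rw [hr.y, Matrix.mulVec_mulVec, hφ.S, Matrix.one_mulVec]

/-! ### Invariance of optimality -/

theorem isLifted_iff {Ω : Quadruple n m p h N} : Ω.IsLifted ↔
    Ω.A (Sum.inr ()) = Pi.single (Sum.inr ()) 1 ∧ Ω.B (Sum.inr ()) = 0 ∧
      Ω.C (Sum.inr ()) = Pi.single (Sum.inr ()) 1 := by
  simp only [IsLifted, funext_iff, ← Matrix.ext_iff, Sum.forall, Matrix.toBlocks₂₁,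
    Matrix.toBlocks₂₂, Matrix.toRows₂]
  simp [and_assoc, Unique.forall_iff]

/-- Compare the last rows of the relations: `P` and `S` have last row `(0, 1)`, and `G` and `P` can
be cancelled on the right. -/
theorem ActRel.isLifted {ψ : IsoGroup n m p} {Ω Ω' : Quadruple n m p h N} (hr : ActRel ψ Ω Ω')
    (hΩ : Ω.IsLifted) : Ω'.IsLifted := by
  rw [isLifted_iff] at hΩ ⊢
  obtain ⟨hA, hB, hC⟩ := hΩ
  have h1 : (Ω'.A * isoP ψ) (Sum.inr ()) + (Ω'.B * isoF ψ) (Sum.inr ())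
      = (isoP ψ * Ω.A) (Sum.inr ()) := congrFun hr.A (Sum.inr ())
  have h2 := congrFun hr.B (Sum.inr ())
  have h3 := congrFun hr.C (Sum.inr ())
  simp only [Matrix.mul_apply_eq_vecMul, isoP_inr, isoS_inr, Matrix.single_one_vecMul,
    Matrix.row] at h1 h2 h3
  have hB' : Ω'.B (Sum.inr ()) = 0 :=
    Matrix.vecMul_injective_of_isUnit (isUnit_isoG ψ) (by simp [h2, hB])
  have hP : Pi.single (Sum.inr ()) 1 = (Pi.single (Sum.inr ()) 1 : Lift n → ℝ) ᵥ* isoP ψ := by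
    rw [Matrix.single_one_vecMul, Matrix.row, isoP_inr]
  refine ⟨?_, hB', ?_⟩
  · refine Matrix.vecMul_injective_of_isUnit (isUnit_isoP ψ) ?_
    simpa [hB', hA, ← hP] using h1
  · refine Matrix.vecMul_injective_of_isUnit (isUnit_isoP ψ) ?_
    simpa [hC, ← hP] using h3

theorem ActRel.linA {ψ : IsoGroup n m p} {Ω Ω' : Quadruple n m p h N} (hr : ActRel ψ Ω Ω')
    (hΩ : Ω.IsLifted) :
    Ω'.linA * Matrix.of ψ.1.1 + Ω'.linB * (isoF ψ).toCols₁ = Matrix.of ψ.1.1 * Ω.linA := by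
  ext i j
  have h1 := congrFun₂ hr.A (Sum.inl i) (Sum.inl j)
  have h2 : Ω.A (Sum.inr ()) (Sum.inl j) = 0 := congrFun₂ hΩ.1 () j
  simpa [Matrix.mul_apply, isoP, h2, Quadruple.linA, Quadruple.linB, Matrix.toBlocks₁₁,
    Matrix.toRows₁, Matrix.toCols₁] using h1

theorem ActRel.linB {ψ : IsoGroup n m p} {Ω Ω' : Quadruple n m p h N} (hr : ActRel ψ Ω Ω')
    (hΩ : Ω.IsLifted) : Ω'.linB * isoG ψ = Matrix.of ψ.1.1 * Ω.linB := by
  ext i j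
  have h1 := congrFun₂ hr.B (Sum.inl i) j
  have h2 : Ω.B (Sum.inr ()) j = 0 := congrFun₂ hΩ.2.2.1 () j
  simpa [Matrix.mul_apply, isoP, h2, Quadruple.linB, Matrix.toRows₁] using h1

theorem ActRel.linC {ψ : IsoGroup n m p} {Ω Ω' : Quadruple n m p h N} (hr : ActRel ψ Ω Ω')
    (hΩ : Ω.IsLifted) :
    Ω'.linC * Matrix.of ψ.1.1 = Matrix.of ψ.1.2.2.2.2.1 * Ω.linC := by
  ext i j
  have h1 := congrFun₂ hr.C (Sum.inl i) (Sum.inl j)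
  have h2 : Ω.C (Sum.inr ()) (Sum.inl j) = 0 := congrFun₂ hΩ.2.2.2.1 () j
  simpa [Matrix.mul_apply, isoP, isoS, h2, Quadruple.linC, Matrix.toBlocks₁₁] using h1

theorem rank_eq_iff_vecMul_eq_zero {ι : Type*} [Fintype ι] (X : Matrix (Fin n) ι ℝ) :
    X.rank = n ↔ ∀ w, w ᵥ* X = 0 → w = 0 := by
  have h1 : (∀ w, w ᵥ* X = 0 → w = 0) ↔ Function.Injective X.vecMul :=
    (injective_iff_map_eq_zero X.vecMulLinear).symm
  rw [h1, Matrix.vecMul_injective_iff]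
  refine ⟨fun hX => ?_, fun hX => by simpa using hX.rank_matrix⟩
  rw [Matrix.rank_eq_finrank_span_row] at hX
  rw [linearIndependent_iff_card_eq_finrank_span, Set.finrank, hX, Fintype.card_fin]

theorem isControllable_iff {Ω : Quadruple n m p h N} : Ω.IsControllable ↔
    ∀ w : Fin n → ℝ, (∀ j < n, w ᵥ* (Ω.linA ^ j * Ω.linB) = 0) → w = 0 := by
  rw [IsControllable, rank_eq_iff_vecMul_eq_zero]
  refine forall_congr' fun w => imp_congr_left ⟨fun hw j hj => ?_, fun hw => ?_⟩
  · ext i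
    exact congrFun hw (⟨j, hj⟩, i)
  · ext i
    exact congrFun (hw i.1 i.1.2) i.2

/-- Controllability survives feedback. A vector `w` annihilating all `A'ʲB'` does not see the term
`B'F`, so `w A'ʲ P = w P Aʲ`; hence `wP` annihilates all `AʲB` and vanishes. -/
theorem ActRel.isControllable {ψ : IsoGroup n m p} {Ω Ω' : Quadruple n m p h N}
    (hr : ActRel ψ Ω Ω') (hΩ : Ω.IsLifted) (hc : Ω.IsControllable) : Ω'.IsControllable := by
  rw [isControllable_iff] at hc ⊢
  intro w hw
  have hP : IsUnit (Matrix.of ψ.1.1) := by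
    rw [Matrix.isUnit_iff_isUnit_det]
    exact isUnit_iff_ne_zero.2 ψ.2.1
  -- The case `j` only uses `w A'ⁱ B' = 0` for `i < j`, so the induction may run up to `n`.
  have key : ∀ j ≤ n, w ᵥ* Ω'.linA ^ j ᵥ* Matrix.of ψ.1.1 = w ᵥ* Matrix.of ψ.1.1 ᵥ* Ω.linA ^ j := by
    intro j hj
    induction j with
    | zero => simp
    | succ j ih =>
      have h1 := hw j (by omega)
      rw [← Matrix.vecMul_vecMul] at h1
      rw [pow_succ Ω.linA, ← Matrix.vecMul_vecMul, ← ih (by omega), Matrix.vecMul_vecMul _ _ Ω.linA,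
        ← hr.linA hΩ, Matrix.vecMul_add, ← Matrix.vecMul_vecMul _ Ω'.linB, h1, Matrix.zero_vecMul,
        add_zero, pow_succ, ← Matrix.vecMul_vecMul, ← Matrix.vecMul_vecMul]
  have h1 : w ᵥ* Matrix.of ψ.1.1 = 0 := by
    refine hc _ fun j hj => ?_
    have h2 := hw j hj
    rw [← Matrix.vecMul_vecMul] at h2
    rw [← Matrix.vecMul_vecMul, ← key j hj.le, Matrix.vecMul_vecMul _ _ Ω.linB, ← hr.linB hΩ,
      ← Matrix.vecMul_vecMul, h2, Matrix.zero_vecMul]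
  exact Matrix.vecMul_injective_of_isUnit hP (by simpa using h1)

theorem ActRel.isTrajectory {ψ : IsoGroup n m p} {Ω Ω' : Quadruple n m p h N}
    (hr : ActRel ψ Ω Ω') {x : ℕ → Lift n → ℝ} {u : ℕ → Fin m → ℝ} {y : ℕ → Lift p → ℝ}
    (ht : Ω.IsTrajectory x u y) : Ω'.IsTrajectory (fun k => isoP ψ *ᵥ x k)
      (fun k => isoF ψ *ᵥ x k + isoG ψ *ᵥ u k) (fun k => isoS ψ *ᵥ y k) := by
  intro k
  obtain ⟨h1, h2, h3⟩ := ht k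
  refine ⟨?_, ?_, ?_⟩
  · change isoP ψ (Sum.inr ()) ⬝ᵥ x k = 1
    rw [isoP_inr, single_one_dotProduct, h1]
  · simp only [h2, Matrix.mulVec_add, Matrix.mulVec_mulVec, ← hr.A, ← hr.B, Matrix.add_mulVec]
    abel
  · simp only [h3, Matrix.mulVec_mulVec, hr.C]

theorem isoL_mulVec (ψ : IsoGroup n m p) (x : Lift n → ℝ) (u : Fin m → ℝ) :
    isoL ψ *ᵥ Sum.elim x u = Sum.elim (isoP ψ *ᵥ x) (isoF ψ *ᵥ x + isoG ψ *ᵥ u) := by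
  rw [isoL, Matrix.fromBlocks_mulVec]
  simp

theorem ActRel.isFeasible {ψ : IsoGroup n m p} {Ω Ω' : Quadruple n m p h N}
    (hr : ActRel ψ Ω Ω') {x : ℕ → Lift n → ℝ} {u : ℕ → Fin m → ℝ} (hf : Ω.IsFeasible x u) :
    Ω'.IsFeasible (fun k => isoP ψ *ᵥ x k) (fun k => isoF ψ *ᵥ x k + isoG ψ *ᵥ u k) := by
  intro i
  have h1 := hf i
  rwa [← hr.D, ← Matrix.mulVec_mulVec, isoL_mulVec] at h1

theorem ActRel.cost_eq {ψ : IsoGroup n m p} {Ω Ω' : Quadruple n m p h N}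
    (hr : ActRel ψ Ω Ω') (x : ℕ → Lift n → ℝ) (u : ℕ → Fin m → ℝ) :
    Ω'.cost (fun k => isoP ψ *ᵥ x k) (fun k => isoF ψ *ᵥ x k + isoG ψ *ᵥ u k) = Ω.cost x u := by
  have hdev : ∀ i, Ω'.deviation (fun k => isoP ψ *ᵥ x k)
      (fun k => isoF ψ *ᵥ x k + isoG ψ *ᵥ u k) i = isoL ψ *ᵥ Ω.deviation x u i := fun i => by
    rw [deviation, deviation, isoL_mulVec, hr.xref, hr.uref]
    simp only [Matrix.mulVec_sub]
    congr 1
    abel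
  refine tsum_congr fun i => ?_
  rw [hdev, ← hr.M, Matrix.mul_assoc, ← Matrix.mulVec_mulVec, ← Matrix.mulVec_mulVec,
    Matrix.dotProduct_mulVec _ (isoL ψ)ᵀ, Matrix.vecMul_transpose]

/-- Observability is absent here because state feedback can destroy it; this is why the orbit is
only claimed to be optimal. -/
theorem IsOptimal.act {Ω : Quadruple n m p h N} (hΩ : Ω.IsOptimal) (ψ : IsoGroup n m p) :
    (act ψ Ω).IsOptimal := by
  obtain ⟨φ, hφ⟩ := exists_isIsoInverse ψ
  have hr := actRel_act ψ Ω
  have hr' := hr.symm hφ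
  constructor
  · exact hr.isLifted hΩ.lifted
  · exact hr.isControllable hΩ.lifted hΩ.controllable
  · have h1 := hr.linB hΩ.lifted
    have hP : IsUnit (Matrix.of ψ.1.1) := by
      rw [Matrix.isUnit_iff_isUnit_det]
      exact isUnit_iff_ne_zero.2 ψ.2.1
    have h2 : (Quadruple.act ψ Ω).linB = Matrix.of ψ.1.1 * Ω.linB * isoG φ := by
      rw [← h1, Matrix.mul_assoc, mul_eq_one_comm.1 hφ.G, Matrix.mul_one]
    have h3 : (Quadruple.act ψ Ω).linB.mulVec
        = (Matrix.of ψ.1.1).mulVec ∘ Ω.linB.mulVec ∘ (isoG φ).mulVec := by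
      funext v
      simp only [h2, Function.comp_apply, Matrix.mulVec_mulVec, Matrix.mul_assoc]
    rw [h3]
    exact (Matrix.mulVec_injective_iff_isUnit.2 hP).comp
      (hΩ.injective_B.comp (Matrix.mulVec_injective_iff_isUnit.2 (isUnit_isoG φ)))
  · have h1 := hr.linC hΩ.lifted
    have hS : IsUnit (Matrix.of ψ.1.2.2.2.2.1) := by
      rw [Matrix.isUnit_iff_isUnit_det]
      exact isUnit_iff_ne_zero.2 ψ.2.2.2
    -- Since `C'P = SC` on linear parts, it is enough that the right side is surjective.
    refine Function.Surjective.of_comp (g := (Matrix.of ψ.1.1).mulVec) ?_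
    have h2 : (Quadruple.act ψ Ω).linC.mulVec ∘ (Matrix.of ψ.1.1).mulVec
        = (Matrix.of ψ.1.2.2.2.2.1).mulVec ∘ Ω.linC.mulVec := by
      funext v
      simp only [Function.comp_apply, Matrix.mulVec_mulVec, h1]
    rw [h2]
    exact (Matrix.mulVec_surjective_iff_isUnit.2 hS).comp hΩ.surjective_C
  · have h1 := hΩ.posDef.conjTranspose_mul_mul_same (B := (isoL ψ)⁻¹)
      (Matrix.mulVec_injective_iff_isUnit.2 (Matrix.isUnit_nonsing_inv_iff.2 (isUnit_isoL ψ)))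
    rwa [Matrix.conjTranspose_eq_transpose_of_trivial] at h1
  · exact hr.isTrajectory hΩ.trajectory
  · exact hr.isFeasible hΩ.feasible
  · exact (hr.cost_eq Ω.x Ω.u).trans_ne hΩ.finite
  -- The inverse key turns a competitor for the transformed problem into one for `Ω` with the same
  -- cost and the matching initial state.
  · intro x u y ht h0 hf
    refine (hr.cost_eq Ω.x Ω.u).trans_le ?_
    rw [← hr'.cost_eq x u]
    refine hΩ.minimal _ _ _ (hr'.isTrajectory ht) ?_ (hr'.isFeasible hf)
    rw [h0, ← hr'.x]

/-! ### Rigidity -/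

theorem eq_zero_of_mul_eq_zero_of_injective {ι κ ν : Type*} [Fintype κ] [Fintype ν] [DecidableEq ν]
    {X : Matrix ι κ ℝ} {Y : Matrix κ ν ℝ} (hX : Function.Injective X.mulVec) (h₀ : X * Y = 0) :
    Y = 0 := by
  refine Matrix.ext_of_mulVec_single fun j => hX ?_
  rw [Matrix.mulVec_mulVec, h₀, Matrix.zero_mulVec, Matrix.zero_mulVec, Matrix.mulVec_zero]

theorem eq_zero_of_mul_eq_zero_of_surjective {ι κ ν : Type*} [Fintype κ] [DecidableEq κ]
    [Fintype ν] {X : Matrix ι κ ℝ} {Y : Matrix κ ν ℝ} (hY : Function.Surjective Y.mulVec)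
    (h₀ : X * Y = 0) : X = 0 := by
  refine Matrix.ext_of_mulVec_single fun j => ?_
  obtain ⟨v, hv⟩ := hY (Pi.single j 1)
  rw [← hv, Matrix.mulVec_mulVec, h₀]
  simp

theorem IsOptimal.injective_liftedB {Ω : Quadruple n m p h N} (hΩ : Ω.IsOptimal) :
    Function.Injective Ω.B.mulVec := fun _ _ hvw =>
  hΩ.injective_B (funext fun i => congrFun hvw (Sum.inl i))

theorem IsOptimal.surjective_liftedC {Ω : Quadruple n m p h N} (hΩ : Ω.IsOptimal) :
    Function.Surjective Ω.C.mulVec := by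
  intro z
  -- The last row of `C` copies the last coordinate, so that coordinate of the preimage is known and
  -- its contribution is subtracted first.
  obtain ⟨v, hv⟩ := hΩ.surjective_C
    fun i => z (Sum.inl i) - Ω.C (Sum.inl i) (Sum.inr ()) * z (Sum.inr ())
  refine ⟨Sum.elim v fun _ => z (Sum.inr ()), funext fun i => ?_⟩
  rcases i with i | ⟨⟩
  · have h1 := congrFun hv i
    simp only [Matrix.mulVec, dotProduct, linC, Matrix.toBlocks₁₁, Matrix.of_apply] at h1
    simp [Matrix.mulVec, dotProduct, h1]
  · have h1 := (isLifted_iff.1 hΩ.lifted).2.2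
    change Ω.C (Sum.inr ()) ⬝ᵥ _ = _
    rw [h1, single_one_dotProduct, Sum.elim_inr]

/-- The bilinear relations between isomorphisms and plants have only the trivial kernel. -/
theorem IsOptimal.eq_zero_of_mul_eq {Ω Ω' : Quadruple n m p h N} (hΩ : Ω.IsOptimal)
    (hΩ' : Ω'.IsOptimal) {q : ℕ} {E : Matrix (Fin q) (Lift n) ℝ}
    (hE : Function.Injective E.mulVec) {P : Matrix (Lift n) (Lift n) ℝ}
    {F : Matrix (Fin m) (Lift n) ℝ} {G : Matrix (Fin m) (Fin m) ℝ} {S : Matrix (Lift p) (Lift p) ℝ}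
    (hD : E * P = 0) (hB : Ω'.B * G = P * Ω.B) (hA : Ω'.A * P + Ω'.B * F = P * Ω.A)
    (hC : Ω'.C * P = S * Ω.C) : P = 0 ∧ F = 0 ∧ G = 0 ∧ S = 0 := by
  have hP := eq_zero_of_mul_eq_zero_of_injective hE hD
  subst hP
  simp only [Matrix.mul_zero, Matrix.zero_mul, zero_add] at hB hA hC
  exact ⟨rfl, eq_zero_of_mul_eq_zero_of_injective hΩ'.injective_liftedB hA,
    eq_zero_of_mul_eq_zero_of_injective hΩ'.injective_liftedB hB,
    eq_zero_of_mul_eq_zero_of_surjective hΩ.surjective_liftedC hC.symm⟩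

/-- The state part of the rows `r` of the constraint matrix `D`. -/
def stateRows (r : Fin (n + 1) → Fin h) (D : Matrix (Fin h) (StIn n m) ℝ) :
    Matrix (Fin (n + 1)) (Lift n) ℝ :=
  D.submatrix r Sum.inl

/-- `L` is block lower triangular. In the input columns, `D'L = D` leaves (input part of the row) `·
G = 0`, and `G` is invertible; `F` then drops out of the state columns. -/
theorem ActRel.stateRows {ψ : IsoGroup n m p} {Ω Ω' : Quadruple n m p h N} (hr : ActRel ψ Ω Ω')
    {r : Fin (n + 1) → Fin h} (hD : ∀ i j, Ω.D (r i) (Sum.inr j) = 0) :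
    stateRows r Ω'.D * isoP ψ = stateRows r Ω.D ∧ ∀ i j, Ω'.D (r i) (Sum.inr j) = 0 := by
  have h2 : ∀ i j, Ω'.D (r i) (Sum.inr j) = 0 := by
    intro i
    refine congrFun (f := fun j => Ω'.D (r i) (Sum.inr j)) (g := 0) ?_
    refine Matrix.vecMul_injective_of_isUnit (isUnit_isoG ψ) (funext fun j => ?_)
    have h1 := congrFun₂ hr.D (r i) (Sum.inr j)
    rw [hD, Matrix.mul_apply, Fintype.sum_sum_type] at h1
    simpa [isoL, Matrix.vecMul, dotProduct] using h1
  refine ⟨?_, h2⟩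
  ext i j
  have h1 := congrFun₂ hr.D (r i) (Sum.inl j)
  rw [Matrix.mul_apply, Fintype.sum_sum_type] at h1
  simpa [isoL, Quadruple.stateRows, Matrix.mul_apply, h2] using h1

/-- The lifted state has `n + 1` coordinates, so `n + 1` independent rows have full column rank as
well. -/
theorem injective_stateRows {D : Matrix (Fin h) (StIn n m) ℝ} {r : Fin (n + 1) → Fin h}
    (hD : LinearIndependent ℝ fun i (j : Lift n) => D (r i) (Sum.inl j)) :
    Function.Injective (stateRows r D).mulVec := by
  have h1 : (stateRows r D).rank = Fintype.card (Lift n) := by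
    refine (LinearIndependent.rank_matrix (M := stateRows r D) hD).trans ?_
    simp
  have h2 := (stateRows r D).mulVecLin.finrank_range_add_finrank_ker
  rw [← Matrix.rank, h1, Module.finrank_fintype_fun_eq_card, Nat.add_eq_left,
    Submodule.finrank_eq_zero] at h2
  exact LinearMap.ker_eq_bot.1 h2

theorem injective_mulVec_of_mul {ι κ : Type*} [Fintype κ] [DecidableEq κ] {X : Matrix ι κ ℝ}
    {Y : Matrix κ κ ℝ} (hXY : Function.Injective (X * Y).mulVec) (hY : IsUnit Y) :
    Function.Injective X.mulVec := by
  refine Function.Injective.of_comp_right (g := Y.mulVec) ?_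
    (Matrix.mulVec_surjective_iff_isUnit.2 hY)
  convert hXY using 1
  funext v
  exact Matrix.mulVec_mulVec _ _ _

theorem isoGroup_ext {ψ φ : IsoGroup n m p} (hP : isoP ψ = isoP φ) (hF : isoF ψ = isoF φ)
    (hG : isoG ψ = isoG φ) (hS : isoS ψ = isoS φ) : ψ = φ := by
  obtain ⟨h1, h2, -⟩ := Matrix.fromBlocks_inj.1 hP
  obtain ⟨h3, h4, -⟩ := Matrix.fromBlocks_inj.1 hS
  refine Subtype.ext (Prod.ext h1 (Prod.ext (funext fun i => congrFun₂ h2 i ()) (Prod.ext hF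
    (Prod.ext hG (Prod.ext h3 (funext fun i => congrFun₂ h4 i ()))))))

/-- Two isomorphisms that map the matrices of `Ω` to the same matrices are equal. -/
theorem IsOptimal.injective_matrices_act {Ω : Quadruple n m p h N} (hΩ : Ω.IsOptimal)
    (hD : Ω.HasStateConstraints) : Function.Injective fun ψ : IsoGroup n m p =>
      (Quadruple.act ψ Ω).matrices := by
  intro ψ φ hψφ
  obtain ⟨r, hr, hli⟩ := hD
  have h1 := actRel_act ψ Ω
  have h2 := actRel_act φ Ω
  have eA : (Quadruple.act ψ Ω).A = (Quadruple.act φ Ω).A := congrArg (fun z => z.1) hψφ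
  have eB : (Quadruple.act ψ Ω).B = (Quadruple.act φ Ω).B := congrArg (fun z => z.2.1) hψφ
  have eC : (Quadruple.act ψ Ω).C = (Quadruple.act φ Ω).C := congrArg (fun z => z.2.2.1) hψφ
  have eD : (Quadruple.act ψ Ω).D = (Quadruple.act φ Ω).D := congrArg (fun z => z.2.2.2.2) hψφ
  have hE := (h1.stateRows hr).1
  have hE' := (h2.stateRows hr).1
  have hA := h2.A
  have hB := h2.B
  have hC := h2.C
  -- Both keys now satisfy the same linear relations, with the same image matrices, so their
  -- difference solves the homogeneous system.
  rw [← eA, ← eB] at hA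
  rw [← eB] at hB
  rw [← eC] at hC
  rw [← eD] at hE'
  have hinj : Function.Injective (Quadruple.stateRows r (Quadruple.act ψ Ω).D).mulVec :=
    injective_mulVec_of_mul (by rw [hE]; exact injective_stateRows hli) (isUnit_isoP ψ)
  obtain ⟨hP, hF, hG, hS⟩ := hΩ.eq_zero_of_mul_eq (hΩ.act ψ) hinj
    (P := isoP ψ - isoP φ) (F := isoF ψ - isoF φ) (G := isoG ψ - isoG φ) (S := isoS ψ - isoS φ)
    (by rw [Matrix.mul_sub, hE, hE', sub_self])
    (by rw [Matrix.mul_sub, Matrix.sub_mul, h1.B, hB])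
    (by rw [Matrix.mul_sub, Matrix.mul_sub, Matrix.sub_mul, ← h1.A, ← hA]; abel)
    (by rw [Matrix.mul_sub, Matrix.sub_mul, h1.C, hC])
  exact isoGroup_ext (sub_eq_zero.1 hP) (sub_eq_zero.1 hF) (sub_eq_zero.1 hG) (sub_eq_zero.1 hS)

theorem exists_iso_eq_one : ∃ ψ : IsoGroup n m p, isoP ψ = 1 ∧ isoF ψ = 0 ∧ isoG ψ = 1 ∧
    isoS ψ = 1 := by
  refine ⟨isoMk 1 0 0 1 1 0 (by simp) (by simp) (by simp), ?_, rfl, rfl, ?_⟩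
  · exact Matrix.fromBlocks_one
  · exact Matrix.fromBlocks_one

theorem actRel_of_eq_one {ψ : IsoGroup n m p} (hP : isoP ψ = 1) (hF : isoF ψ = 0)
    (hG : isoG ψ = 1) (hS : isoS ψ = 1) (Ω : Quadruple n m p h N) : ActRel ψ Ω Ω := by
  have hL : isoL ψ = 1 := by rw [isoL, hP, hF, hG, Matrix.fromBlocks_one]
  constructor <;> simp [hP, hF, hG, hS, hL]

/-- The identity key fixes `Ω`, so a second key fixing it would contradict injectivity of the orbit
map. -/
theorem IsOptimal.act_eq_self_iff {Ω : Quadruple n m p h N} (hΩ : Ω.IsOptimal)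
    (hD : Ω.HasStateConstraints) (ψ : IsoGroup n m p) : Quadruple.act ψ Ω = Ω ↔
      (isoP ψ = 1 ∧ isoF ψ = 0 ∧ isoG ψ = 1 ∧ isoS ψ = 1) := by
  refine ⟨fun hψ => ?_, fun ⟨hP, hF, hG, hS⟩ => (actRel_of_eq_one hP hF hG hS Ω).eq_act.symm⟩
  obtain ⟨φ, hP, hF, hG, hS⟩ := exists_iso_eq_one (n := n) (m := m) (p := p)
  have h1 := (actRel_of_eq_one hP hF hG hS Ω).eq_act
  have h2 : ψ = φ := hΩ.injective_matrices_act hD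
    (congrArg Quadruple.matrices (hψ.trans h1))
  rw [h2]
  exact ⟨hP, hF, hG, hS⟩

theorem messages_eq_of_act_eq {Ω Ω' : Quadruple n m p h N} {ψ φ : IsoGroup n m p}
    (hψφ : act ψ Ω = act φ Ω') : Ω.messages ψ = Ω'.messages φ := by
  ext1
  · exact congrArg Quadruple.A hψφ
  · exact congrArg Quadruple.B hψφ
  · exact congrArg Quadruple.C hψφ
  · exact congrArg Quadruple.M hψφ
  · exact congrArg Quadruple.xref hψφ
  · exact congrArg Quadruple.uref hψφ
  · exact congrArg Quadruple.D hψφ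
  · exact congrArg Quadruple.y hψφ
  · exact congrArg Quadruple.u hψφ

/-- `Ω` serves as the common image of all these quadruples; two quadruples sent to it by suitable
keys exchange the same messages. -/
theorem exists_act_eq_of_mem_insert {E : Type*} {Ω : Quadruple n m p h N}
    {ρ : IsoGroup n m p → E} {l : E} {Ω' : Quadruple n m p h N}
    (hΩ' : Ω' ∈ insert Ω (Ω.uncertaintySet ρ l)) : ∃ φ, act φ Ω' = Ω := by
  rcases hΩ' with rfl | ⟨ψ, -, rfl⟩
  · obtain ⟨φ, hP, hF, hG, hS⟩ := exists_iso_eq_one (n := n) (m := m) (p := p)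
    exact ⟨φ, (actRel_of_eq_one hP hF hG hS _).eq_act.symm⟩
  · obtain ⟨φ, hφ⟩ := exists_isIsoInverse ψ
    exact ⟨φ, ((actRel_act ψ Ω).symm hφ).eq_act.symm⟩

end Quadruple

/-! ### Smoothness of matrix operations -/

section EntrySmooth

variable {V : Type*} [NormedAddCommGroup V] [NormedSpace ℝ V] {s : Set V} {ι κ ν τ : Type*}

/-- All entries of the matrix-valued function are smooth on `s`. -/
def EntrySmoothOn (X : V → Matrix ι κ ℝ) (s : Set V) : Prop :=
  ∀ i j, ContDiffOn ℝ ∞ (fun v => X v i j) s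

theorem entrySmoothOn_const (X : Matrix ι κ ℝ) : EntrySmoothOn (fun _ : V => X) s :=
  fun _ _ => contDiffOn_const

theorem EntrySmoothOn.mul [Fintype κ] {X : V → Matrix ι κ ℝ} {Y : V → Matrix κ ν ℝ}
    (hX : EntrySmoothOn X s) (hY : EntrySmoothOn Y s) : EntrySmoothOn (fun v => X v * Y v) s := by
  intro i j
  simp only [Matrix.mul_apply]
  exact ContDiffOn.sum fun k _ => (hX i k).mul (hY k j)

theorem EntrySmoothOn.sub {X Y : V → Matrix ι κ ℝ} (hX : EntrySmoothOn X s)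
    (hY : EntrySmoothOn Y s) : EntrySmoothOn (fun v => X v - Y v) s :=
  fun i j => (hX i j).sub (hY i j)

theorem EntrySmoothOn.transpose {X : V → Matrix ι κ ℝ} (hX : EntrySmoothOn X s) :
    EntrySmoothOn (fun v => (X v)ᵀ) s :=
  fun i j => hX j i

theorem EntrySmoothOn.fromBlocks {X : V → Matrix ι κ ℝ} {Y : V → Matrix ι ν ℝ}
    {Z : V → Matrix τ κ ℝ} {T : V → Matrix τ ν ℝ} (hX : EntrySmoothOn X s)
    (hY : EntrySmoothOn Y s) (hZ : EntrySmoothOn Z s) (hT : EntrySmoothOn T s) :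
    EntrySmoothOn (fun v => Matrix.fromBlocks (X v) (Y v) (Z v) (T v)) s := by
  rintro (i | i) (j | j)
  exacts [hX i j, hY i j, hZ i j, hT i j]

theorem EntrySmoothOn.det [Fintype ι] [DecidableEq ι] {X : V → Matrix ι ι ℝ}
    (hX : EntrySmoothOn X s) : ContDiffOn ℝ ∞ (fun v => (X v).det) s := by
  simp only [Matrix.det_apply']
  exact ContDiffOn.sum fun σ _ => contDiffOn_const.mul (contDiffOn_prod fun i _ => hX _ _)

/-- Cramer's rule: an entry of the inverse is a determinant divided by the nonvanishing `det X`. -/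
theorem EntrySmoothOn.inv [Fintype ι] [DecidableEq ι] {X : V → Matrix ι ι ℝ}
    (hX : EntrySmoothOn X s) (hs : ∀ v ∈ s, IsUnit (X v)) : EntrySmoothOn (fun v => (X v)⁻¹) s := by
  intro i j
  simp only [Matrix.inv_def, Matrix.smul_apply, smul_eq_mul, Ring.inverse_eq_inv',
    Matrix.adjugate_apply]
  refine (hX.det.inv fun v hv => ((Matrix.isUnit_iff_isUnit_det _).1 (hs v hv)).ne_zero).mul
    (EntrySmoothOn.det fun a b => ?_)
  -- Row `j` has been replaced by a constant unit vector; the other rows are those of `X`.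
  by_cases ha : a = j
  · subst ha
    simpa using contDiffOn_const
  · simpa [Matrix.updateRow_ne ha] using hX a b

theorem EntrySmoothOn.mulVec [Fintype κ] {X : V → Matrix ι κ ℝ} (hX : EntrySmoothOn X s)
    (w : κ → ℝ) : ∀ i, ContDiffOn ℝ ∞ (fun v => (X v *ᵥ w) i) s := by
  intro i
  simp only [Matrix.mulVec, dotProduct]
  exact ContDiffOn.sum fun k _ => (hX i k).mul contDiffOn_const

/-- Derivative of a product when the first factor is stationary and the second one is affine. -/
theorem hasDerivAt_mul_add_smul [Fintype κ] {X : ℝ → Matrix ι κ ℝ}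
    (hX : ∀ i j, HasDerivAt (fun t => X t i j) 0 0) (Y Z : Matrix κ ν ℝ) (i : ι) (j : ν) :
    HasDerivAt (fun t => (X t * (Y + t • Z)) i j) ((X 0 * Z) i j) 0 := by
  simp only [Matrix.mul_apply]
  refine HasDerivAt.fun_sum fun k _ => ?_
  have h1 : HasDerivAt (fun t : ℝ => (Y + t • Z) k j) (Z k j) 0 := by
    simpa using ((hasDerivAt_id (0 : ℝ)).mul_const (Z k j)).const_add (Y k j)
  simpa using (hX i k).fun_mul h1

theorem hasDerivAt_add_smul_mul [Fintype κ] (Y Z : Matrix ι κ ℝ) (X : Matrix κ ν ℝ) (i : ι)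
    (j : ν) : HasDerivAt (fun t : ℝ => ((Y + t • Z) * X) i j) ((Z * X) i j) 0 := by
  simp only [Matrix.add_mul, Matrix.smul_mul, Matrix.add_apply, Matrix.smul_apply, smul_eq_mul]
  simpa using ((hasDerivAt_id (0 : ℝ)).mul_const ((Z * X) i j)).const_add ((Y * X) i j)

end EntrySmooth

/-! ### The action in coordinates -/

section Coordinates

variable {n m p h : ℕ} {N : ℕ∞}

/-- The lifted matrix of `P`, for arbitrary parameters. -/
def keyP (v : KeySpace n m p) : Matrix (Lift n) (Lift n) ℝ :=
  Matrix.fromBlocks (Matrix.of v.1) (Matrix.replicateCol Unit v.2.1) 0 1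

/-- The lifted matrix of `F`, for arbitrary parameters. -/
def keyF (v : KeySpace n m p) : Matrix (Fin m) (Lift n) ℝ := Matrix.of v.2.2.1

/-- The matrix of `G`, for arbitrary parameters. -/
def keyG (v : KeySpace n m p) : Matrix (Fin m) (Fin m) ℝ := Matrix.of v.2.2.2.1

/-- The lifted matrix of `S`, for arbitrary parameters. -/
def keyS (v : KeySpace n m p) : Matrix (Lift p) (Lift p) ℝ :=
  Matrix.fromBlocks (Matrix.of v.2.2.2.2.1) (Matrix.replicateCol Unit v.2.2.2.2.2) 0 1

/-- The matrix `L`, for arbitrary parameters. -/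
def keyL (v : KeySpace n m p) : Matrix (StIn n m) (StIn n m) ℝ :=
  Matrix.fromBlocks (keyP v) 0 (keyF v) (keyG v)

/-- The linear part of `keyP`. -/
def keyDirP (ξ : KeySpace n m p) : Matrix (Lift n) (Lift n) ℝ :=
  Matrix.fromBlocks (Matrix.of ξ.1) (Matrix.replicateCol Unit ξ.2.1) 0 0

/-- The linear part of `keyS`. -/
def keyDirS (ξ : KeySpace n m p) : Matrix (Lift p) (Lift p) ℝ :=
  Matrix.fromBlocks (Matrix.of ξ.2.2.2.2.1) (Matrix.replicateCol Unit ξ.2.2.2.2.2) 0 0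

theorem keyP_add_smul (v ξ : KeySpace n m p) (t : ℝ) :
    keyP (v + t • ξ) = keyP v + t • keyDirP ξ := by
  ext (i | i) (j | j) <;> simp [keyP, keyDirP]

theorem keyS_add_smul (v ξ : KeySpace n m p) (t : ℝ) :
    keyS (v + t • ξ) = keyS v + t • keyDirS ξ := by
  ext (i | i) (j | j) <;> simp [keyS, keyDirS]

theorem keyF_add_smul (v ξ : KeySpace n m p) (t : ℝ) :
    keyF (v + t • ξ) = keyF v + t • keyF ξ := rfl

theorem keyG_add_smul (v ξ : KeySpace n m p) (t : ℝ) :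
    keyG (v + t • ξ) = keyG v + t • keyG ξ := rfl

theorem eq_zero_of_keyDir {ξ : KeySpace n m p} (hP : keyDirP ξ = 0) (hF : keyF ξ = 0)
    (hG : keyG ξ = 0) (hS : keyDirS ξ = 0) : ξ = 0 := by
  rw [keyDirP, ← Matrix.fromBlocks_zero] at hP
  rw [keyDirS, ← Matrix.fromBlocks_zero] at hS
  obtain ⟨h1, h2, -⟩ := Matrix.fromBlocks_inj.1 hP
  obtain ⟨h3, h4, -⟩ := Matrix.fromBlocks_inj.1 hS
  exact Prod.ext h1 (Prod.ext (funext fun i => congrFun₂ h2 i ()) (Prod.ext hF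
    (Prod.ext hG (Prod.ext h3 (funext fun i => congrFun₂ h4 i ())))))

theorem entrySmoothOn_keyP (s : Set (KeySpace n m p)) : EntrySmoothOn keyP s := by
  refine EntrySmoothOn.fromBlocks (fun i j => ContDiff.contDiffOn ?_)
    (fun i j => ContDiff.contDiffOn ?_) (entrySmoothOn_const _) (entrySmoothOn_const _)
  · simp only [Matrix.of_apply]; fun_prop
  · simp only [Matrix.replicateCol_apply]; fun_prop

theorem entrySmoothOn_keyF (s : Set (KeySpace n m p)) : EntrySmoothOn keyF s := by
  refine fun i j => ContDiff.contDiffOn ?_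
  simp only [keyF, Matrix.of_apply]; fun_prop

theorem entrySmoothOn_keyG (s : Set (KeySpace n m p)) : EntrySmoothOn keyG s := by
  refine fun i j => ContDiff.contDiffOn ?_
  simp only [keyG, Matrix.of_apply]; fun_prop

theorem entrySmoothOn_keyS (s : Set (KeySpace n m p)) : EntrySmoothOn keyS s := by
  refine EntrySmoothOn.fromBlocks (fun i j => ContDiff.contDiffOn ?_)
    (fun i j => ContDiff.contDiffOn ?_) (entrySmoothOn_const _) (entrySmoothOn_const _)
  · simp only [Matrix.of_apply]; fun_prop
  · simp only [Matrix.replicateCol_apply]; fun_prop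

theorem entrySmoothOn_keyL (s : Set (KeySpace n m p)) : EntrySmoothOn keyL s :=
  (entrySmoothOn_keyP s).fromBlocks (entrySmoothOn_const _) (entrySmoothOn_keyF s)
    (entrySmoothOn_keyG s)

namespace Quadruple

/-- The matrix part of `ψ_* Ω` as a function of the parameters of `ψ`. -/
noncomputable def actMatrices (Ω : Quadruple n m p h N) (v : KeySpace n m p) :
    MatrixSpace n m p h :=
  (keyP v * (Ω.A - Ω.B * (keyG v)⁻¹ * keyF v) * (keyP v)⁻¹, keyP v * Ω.B * (keyG v)⁻¹,
    keyS v * Ω.C * (keyP v)⁻¹, (keyL v)⁻¹ᵀ * Ω.M * (keyL v)⁻¹, Ω.D * (keyL v)⁻¹)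

theorem contDiffOn_actMatrices (Ω : Quadruple n m p h N) :
    ContDiffOn ℝ ∞ Ω.actMatrices (IsoGroup n m p : Set (KeySpace n m p)) := by
  have hP := entrySmoothOn_keyP (IsoGroup n m p : Set (KeySpace n m p))
  have hF := entrySmoothOn_keyF (IsoGroup n m p : Set (KeySpace n m p))
  have hG := entrySmoothOn_keyG (IsoGroup n m p : Set (KeySpace n m p))
  have hS := entrySmoothOn_keyS (IsoGroup n m p : Set (KeySpace n m p))
  have hP' := hP.inv fun v hv => isUnit_isoP ⟨v, hv⟩
  have hG' := hG.inv fun v hv => isUnit_isoG ⟨v, hv⟩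
  have hL' := (entrySmoothOn_keyL (IsoGroup n m p : Set (KeySpace n m p))).inv
    fun v hv => isUnit_isoL ⟨v, hv⟩
  have hA : EntrySmoothOn (fun v => keyP v * (Ω.A - Ω.B * (keyG v)⁻¹ * keyF v) * (keyP v)⁻¹)
      (IsoGroup n m p : Set (KeySpace n m p)) :=
    (hP.mul ((entrySmoothOn_const _).sub (((entrySmoothOn_const _).mul hG').mul hF))).mul hP'
  have hB : EntrySmoothOn (fun v => keyP v * Ω.B * (keyG v)⁻¹)
      (IsoGroup n m p : Set (KeySpace n m p)) := (hP.mul (entrySmoothOn_const _)).mul hG'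
  have hC : EntrySmoothOn (fun v => keyS v * Ω.C * (keyP v)⁻¹)
      (IsoGroup n m p : Set (KeySpace n m p)) := (hS.mul (entrySmoothOn_const _)).mul hP'
  have hM : EntrySmoothOn (fun v => (keyL v)⁻¹ᵀ * Ω.M * (keyL v)⁻¹)
      (IsoGroup n m p : Set (KeySpace n m p)) := (hL'.transpose.mul (entrySmoothOn_const _)).mul hL'
  have hD : EntrySmoothOn (fun v => Ω.D * (keyL v)⁻¹)
      (IsoGroup n m p : Set (KeySpace n m p)) := (entrySmoothOn_const _).mul hL'
  exact (contDiffOn_pi.2 fun i => contDiffOn_pi.2 (hA i)).prodMk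
    ((contDiffOn_pi.2 fun i => contDiffOn_pi.2 (hB i)).prodMk
      ((contDiffOn_pi.2 fun i => contDiffOn_pi.2 (hC i)).prodMk
        ((contDiffOn_pi.2 fun i => contDiffOn_pi.2 (hM i)).prodMk
          (contDiffOn_pi.2 fun i => contDiffOn_pi.2 (hD i)))))

/-- The orbit map is an immersion. -/
theorem IsOptimal.injective_fderiv_actMatrices {Ω : Quadruple n m p h N} (hΩ : Ω.IsOptimal)
    (hD : Ω.HasStateConstraints) (ψ : IsoGroup n m p) :
    Function.Injective (fderiv ℝ Ω.actMatrices ψ) := by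
  rw [injective_iff_map_eq_zero]
  intro ξ hξ
  obtain ⟨r, hr, hli⟩ := hD
  -- For `ξ` in the kernel, the image matrices are stationary to first order along the line `ψ +
  -- tξ`. Differentiating the relations at `t = 0` therefore leaves the homogeneous system for the
  -- components of `ξ`.
  have hline : HasDerivAt (fun t : ℝ => (ψ : KeySpace n m p) + t • ξ) ξ 0 := by
    simpa using ((hasDerivAt_id (0 : ℝ)).smul_const ξ).const_add (ψ : KeySpace n m p)
  have hline₀ : (ψ : KeySpace n m p) + (0 : ℝ) • ξ = ψ := by simp
  have hev : ∀ᶠ t : ℝ in nhds 0, (ψ : KeySpace n m p) + t • ξ ∈ IsoGroup n m p := by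
    refine hline.continuousAt.eventually_mem ?_
    rw [hline₀]
    exact (IsoGroup n m p).isOpen.mem_nhds ψ.2
  have hder : HasDerivAt (fun t : ℝ => Ω.actMatrices (ψ + t • ξ)) 0 0 := by
    have h1 : HasFDerivAt Ω.actMatrices (fderiv ℝ Ω.actMatrices ψ)
        ((ψ : KeySpace n m p) + (0 : ℝ) • ξ) := by
      rw [hline₀]
      exact ((Ω.contDiffOn_actMatrices.contDiffAt
        ((IsoGroup n m p).isOpen.mem_nhds ψ.2)).differentiableAt (by simp)).hasFDerivAt
    have h2 := h1.comp_hasDerivAt (0 : ℝ) hline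
    rwa [hξ] at h2
  let X : ℝ → MatrixSpace n m p h := fun t => Ω.actMatrices (ψ + t • ξ)
  have hX₀ : X 0 = (Quadruple.act ψ Ω).matrices := congrArg Ω.actMatrices hline₀
  -- The relations hold only while the line stays in the open set of isomorphisms, which suffices
  -- for derivatives at `0`.
  have hrel : ∀ᶠ t : ℝ in nhds 0, ∃ φ : IsoGroup n m p, φ.1 = ψ.1 + t • ξ ∧
      (Quadruple.act φ Ω).matrices = X t := by
    filter_upwards [hev] with t ht
    exact ⟨⟨_, ht⟩, rfl, rfl⟩
  have h1 : ∀ i j, HasDerivAt (fun t => Matrix.of (X t).1 i j) 0 0 := fun i j =>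
    hasDerivAt_pi.1 (hasDerivAt_pi.1 hder.fst i) j
  have h2 : ∀ i j, HasDerivAt (fun t => Matrix.of (X t).2.1 i j) 0 0 := fun i j =>
    hasDerivAt_pi.1 (hasDerivAt_pi.1 hder.snd.fst i) j
  have h3 : ∀ i j, HasDerivAt (fun t => Matrix.of (X t).2.2.1 i j) 0 0 := fun i j =>
    hasDerivAt_pi.1 (hasDerivAt_pi.1 hder.snd.snd.fst i) j
  have h5 : ∀ i j, HasDerivAt (fun t => stateRows r (Matrix.of (X t).2.2.2.2) i j) 0 0 :=
    fun i j => hasDerivAt_pi.1 (hasDerivAt_pi.1 hder.snd.snd.snd.snd (r i)) (Sum.inl j)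
  have hinj : Function.Injective (Quadruple.stateRows r (Quadruple.act ψ Ω).D).mulVec :=
    injective_mulVec_of_mul (by
      rw [((actRel_act ψ Ω).stateRows hr).1]; exact injective_stateRows hli) (isUnit_isoP ψ)
  suffices hz : keyDirP ξ = 0 ∧ keyF ξ = 0 ∧ keyG ξ = 0 ∧ keyDirS ξ = 0 from
    eq_zero_of_keyDir hz.1 hz.2.1 hz.2.2.1 hz.2.2.2
  refine hΩ.eq_zero_of_mul_eq (hΩ.act ψ) hinj ?_ ?_ ?_ ?_
  · ext i j
    have h6 := hasDerivAt_mul_add_smul h5 (keyP ψ.1) (keyDirP ξ) i j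
    -- The product of the state rows with `P` is the constant matrix of state rows of `Ω`, so its
    -- derivative is zero.
    have h7 := h6.congr_of_eventuallyEq (f₁ := fun _ => stateRows r Ω.D i j) (by
      filter_upwards [hrel] with t ⟨φ, hφ, hφX⟩
      rw [← keyP_add_smul, ← hφ, ← hφX]
      exact congrFun₂ ((actRel_act φ Ω).stateRows hr).1.symm i j)
    rw [hX₀] at h7
    exact h7.unique (hasDerivAt_const _ _)
  · ext i j
    have h6 := hasDerivAt_mul_add_smul h2 (keyG ψ.1) (keyG ξ) i j
    have h7 := (hasDerivAt_add_smul_mul (keyP ψ.1) (keyDirP ξ) Ω.B i j).congr_of_eventuallyEq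
      (f₁ := fun t => (Matrix.of (X t).2.1 * (keyG ψ.1 + t • keyG ξ)) i j) (by
      filter_upwards [hrel] with t ⟨φ, hφ, hφX⟩
      rw [← keyP_add_smul, ← keyG_add_smul, ← hφ, ← hφX]
      exact congrFun₂ (actRel_act φ Ω).B i j)
    rw [hX₀] at h6
    exact h6.unique h7
  · ext i j
    have h6 := (hasDerivAt_mul_add_smul h1 (keyP ψ.1) (keyDirP ξ) i j).add
      (hasDerivAt_mul_add_smul h2 (keyF ψ.1) (keyF ξ) i j)
    have h7 := (hasDerivAt_add_smul_mul (keyP ψ.1) (keyDirP ξ) Ω.A i j).congr_of_eventuallyEq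
      (f₁ := (fun t => (Matrix.of (X t).1 * (keyP ψ.1 + t • keyDirP ξ)) i j) +
        fun t => (Matrix.of (X t).2.1 * (keyF ψ.1 + t • keyF ξ)) i j) (by
      filter_upwards [hrel] with t ⟨φ, hφ, hφX⟩
      rw [Pi.add_apply, ← keyP_add_smul, ← keyF_add_smul, ← hφ, ← hφX]
      exact congrFun₂ (actRel_act φ Ω).A i j)
    rw [hX₀] at h6
    exact h6.unique h7
  · ext i j
    have h6 := hasDerivAt_mul_add_smul h3 (keyP ψ.1) (keyDirP ξ) i j
    have h7 := (hasDerivAt_add_smul_mul (keyS ψ.1) (keyDirS ξ) Ω.C i j).congr_of_eventuallyEq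
      (f₁ := fun t => (Matrix.of (X t).2.2.1 * (keyP ψ.1 + t • keyDirP ξ)) i j) (by
      filter_upwards [hrel] with t ⟨φ, hφ, hφX⟩
      rw [← keyP_add_smul, ← keyS_add_smul, ← hφ, ← hφX]
      exact congrFun₂ (actRel_act φ Ω).C i j)
    rw [hX₀] at h6
    exact h6.unique h7

end Quadruple

end Coordinates

/-! ### Functions on the group of isomorphisms -/

section Extension

variable {n m p : ℕ} {E : Type*} [NormedAddCommGroup E]

open Classical in
/-- Extension by zero of a function on the group of isomorphisms. -/
noncomputable def extendIso (ρ : IsoGroup n m p → E) (v : KeySpace n m p) : E :=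
  if hv : v ∈ IsoGroup n m p then ρ ⟨v, hv⟩ else 0

theorem extendIso_coe (ρ : IsoGroup n m p → E) (ψ : IsoGroup n m p) :
    extendIso ρ ψ = ρ ψ := dif_pos ψ.2

variable [NormedSpace ℝ E]

/-- The group is open and smoothness is local, so the value chosen outside is irrelevant. The
extension lets the level set theorem for vector spaces be applied. -/
theorem contDiffAt_extendIso {ρ : IsoGroup n m p → E}
    (hρ : ContMDiff 𝓘(ℝ, KeySpace n m p) 𝓘(ℝ, E) ∞ ρ) (ψ : IsoGroup n m p) :
    ContDiffAt ℝ ∞ (extendIso ρ) ψ := by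
  rw [← contMDiffAt_iff_contDiffAt, ← contMDiffAt_subtype_iff]
  simp only [extendIso_coe]
  exact hρ ψ

/-- Full rank means surjective derivative; `ρ` is the extension after the inclusion, so surjectivity
passes to the extension. -/
theorem surjective_fderiv_extendIso [FiniteDimensional ℝ E] {ρ : IsoGroup n m p → E}
    (hρ : ContMDiff 𝓘(ℝ, KeySpace n m p) 𝓘(ℝ, E) ∞ ρ) {ψ : IsoGroup n m p}
    (hrank : Module.finrank ℝ (LinearMap.range
      (mfderiv 𝓘(ℝ, KeySpace n m p) 𝓘(ℝ, E) ρ ψ).toLinearMap) = Module.finrank ℝ E) :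
    Function.Surjective (fderiv ℝ (extendIso ρ) ψ) := by
  have h1 : ρ = extendIso ρ ∘ Subtype.val := funext fun ψ => (extendIso_coe ρ ψ).symm
  have h2 := mfderiv_comp ψ ((contDiffAt_extendIso hρ ψ).contMDiffAt.mdifferentiableAt (by simp))
    ((contMDiff_subtype_val (I := 𝓘(ℝ, KeySpace n m p)) (n := ∞)
      (U := IsoGroup n m p)).mdifferentiableAt (by simp) (x := ψ))
  rw [← h1, mfderiv_eq_fderiv] at h2
  have : FiniteDimensional ℝ (TangentSpace 𝓘(ℝ, E) (ρ ψ)) := ‹FiniteDimensional ℝ E›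
  have h3 : Function.Surjective (mfderiv 𝓘(ℝ, KeySpace n m p) 𝓘(ℝ, E) ρ ψ) :=
    LinearMap.range_eq_top.1 (Submodule.eq_top_of_finrank_eq hrank)
  rw [h2] at h3
  exact Function.Surjective.of_comp h3

end Extension

/-! ### Dimension count and the manifold structure of the uncertainty set -/

theorem finrank_keySpace (n m p : ℕ) :
    Module.finrank ℝ (KeySpace n m p) = n * (n + 1) + m * (n + 1) + m ^ 2 + p * (p + 1) := by
  simp only [Module.finrank_prod, Module.finrank_pi_fintype, Module.finrank_self, Finset.sum_const,
    Finset.card_univ, Fintype.card_fin, Fintype.card_sum, Fintype.card_unit, smul_eq_mul]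
  ring

namespace Quadruple

variable {n m p h k : ℕ} {N : ℕ∞}

theorem isImmersedSubmanifold_uncertaintySet {Ω : Quadruple n m p h N} (hΩ : Ω.IsOptimal)
    (hD : Ω.HasStateConstraints) {ρ : IsoGroup n m p → EuclideanSpace ℝ (Fin k)}
    (hρ : ContMDiff 𝓘(ℝ, KeySpace n m p) 𝓘(ℝ, EuclideanSpace ℝ (Fin k)) ∞ ρ)
    (hrank : ∀ ψ, Module.finrank ℝ (LinearMap.range
      (mfderiv 𝓘(ℝ, KeySpace n m p) 𝓘(ℝ, EuclideanSpace ℝ (Fin k)) ρ ψ).toLinearMap) = k)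
    (l : EuclideanSpace ℝ (Fin k)) {d : ℕ} (hd : d + k = Module.finrank ℝ (KeySpace n m p)) :
    IsImmersedSubmanifold d (Ω.uncertaintySet ρ l) := by
  have hO : IsOpen (IsoGroup n m p : Set (KeySpace n m p)) := (IsoGroup n m p).isOpen
  obtain ⟨ch, hman, hval, himm⟩ := exists_manifold_levelSet (f := extendIso ρ) hO
    (fun v hv => (contDiffAt_extendIso hρ ⟨v, hv⟩).contDiffWithinAt) l
    (fun v hv _ => surjective_fderiv_extendIso (ψ := ⟨v, hv⟩) hρ (by rw [hrank]; simp))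
    (d := d) (by simpa using hd)
  have hcomp : ∀ {T : Type} [NormedAddCommGroup T] [NormedSpace ℝ T] {g : KeySpace n m p → T},
      ContDiffOn ℝ ∞ g (IsoGroup n m p : Set (KeySpace n m p)) →
      ContMDiff (𝓡 d) 𝓘(ℝ, T) ∞ fun w : {v // v ∈ (IsoGroup n m p : Set (KeySpace n m p)) ∧
        extendIso ρ v = l} => g w.1 := fun hg =>
    hg.contMDiffOn.comp_contMDiff hval fun w => w.2.1
  have hP := entrySmoothOn_keyP (IsoGroup n m p : Set (KeySpace n m p))
  have hF := entrySmoothOn_keyF (IsoGroup n m p : Set (KeySpace n m p))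
  have hG := entrySmoothOn_keyG (IsoGroup n m p : Set (KeySpace n m p))
  have hS := entrySmoothOn_keyS (IsoGroup n m p : Set (KeySpace n m p))
  refine ⟨{v // v ∈ (IsoGroup n m p : Set (KeySpace n m p)) ∧ extendIso ρ v = l}, inferInstance, ch,
    fun w => act ⟨w.1, w.2.1⟩ Ω, inferInstance, inferInstance, hman, ?_, ?_, ?_, ?_, ?_, ?_, ?_, ?_,
    ?_⟩
  · ext Ω'
    constructor
    · rintro ⟨w, rfl⟩
      exact ⟨⟨w.1, w.2.1⟩, (extendIso_coe ρ ⟨w.1, w.2.1⟩).symm.trans w.2.2, rfl⟩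
    · rintro ⟨ψ, hψ, rfl⟩
      exact ⟨⟨ψ.1, ψ.2, (extendIso_coe ρ ψ).trans hψ⟩, rfl⟩
  · intro w w' hw
    have h1 := hΩ.injective_matrices_act hD hw
    exact Subtype.ext (congrArg (fun ψ => ψ.1) h1)
  · exact hcomp Ω.contDiffOn_actMatrices
  · intro w
    have h1 : MDifferentiableAt 𝓘(ℝ, KeySpace n m p) 𝓘(ℝ, MatrixSpace n m p h) Ω.actMatrices w.1 :=
      (Ω.contDiffOn_actMatrices.contDiffAt (hO.mem_nhds w.2.1)).contMDiffAt.mdifferentiableAt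
        (by simp)
    have h2 := mfderiv_comp w h1 (hval.mdifferentiableAt (by simp))
    rw [mfderiv_eq_fderiv] at h2
    -- By the chain rule the derivative is that of the orbit map after that of the inclusion, and
    -- both are injective.
    change Function.Injective (mfderiv (𝓡 d) 𝓘(ℝ, MatrixSpace n m p h)
      (Ω.actMatrices ∘ Subtype.val) w)
    rw [h2]
    exact (hΩ.injective_fderiv_actMatrices hD ⟨w.1, w.2.1⟩).comp (himm w)
  · exact fun i => hcomp (contDiffOn_pi.2 (hP.mulVec _))
  · exact fun i => hcomp (contDiffOn_pi.2 fun j => (hF.mulVec _ j).add (hG.mulVec _ j))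
  · exact fun i => hcomp (contDiffOn_pi.2 (hP.mulVec _))
  · exact fun i => hcomp (contDiffOn_pi.2 fun j => (hF.mulVec _ j).add (hG.mulVec _ j))
  · exact fun i => hcomp (contDiffOn_pi.2 (hS.mulVec _))

end Quadruple

theorem mainTheorem6 (n m p h k : ℕ) (N : ℕ∞) (Ω : Quadruple n m p h N)
    (hΩ : Ω.IsAdmissible) (hD : Ω.HasStateConstraints)
    (ρ : IsoGroup n m p → EuclideanSpace ℝ (Fin k))
    (hρ : ContMDiff 𝓘(ℝ, KeySpace n m p) 𝓘(ℝ, EuclideanSpace ℝ (Fin k)) ∞ ρ)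
    (hrank : ∀ ψ, Module.finrank ℝ (LinearMap.range
      (mfderiv 𝓘(ℝ, KeySpace n m p) 𝓘(ℝ, EuclideanSpace ℝ (Fin k)) ρ ψ).toLinearMap) = k)
    (hsurj : Function.Surjective ρ) (l : EuclideanSpace ℝ (Fin k)) :
    -- the stabilizer of `Ω` consists of the identity isomorphism `(I, 0, I, I)` only
    (∀ ψ : IsoGroup n m p, Quadruple.act ψ Ω = Ω ↔
      (isoP ψ = 1 ∧ isoF ψ = 0 ∧ isoG ψ = 1 ∧ isoS ψ = 1)) ∧
    -- the uncertainty set consists of quadruples with optimal trajectories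
    (∀ Ω' ∈ Ω.uncertaintySet ρ l, Ω'.IsOptimal) ∧
    -- the cloud cannot distinguish its elements from `Ω`, nor from each other
    (∀ Ω' ∈ Ω.uncertaintySet ρ l, ∃ ψ ψ' : IsoGroup n m p,
      ρ ψ = l ∧ Ω.messages ψ = Ω'.messages ψ') ∧
    (∀ Ω₁ ∈ insert Ω (Ω.uncertaintySet ρ l), ∀ Ω₂ ∈ insert Ω (Ω.uncertaintySet ρ l),
      Quadruple.Indistinguishable Ω₁ Ω₂) ∧
    -- its dimension is `dim 𝒢 - k`
    Module.finrank ℝ (KeySpace n m p) = n * (n + 1) + m * (n + 1) + m ^ 2 + p * (p + 1) ∧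
    ∃ d : ℕ, d + k = n * (n + 1) + m * (n + 1) + m ^ 2 + p * (p + 1) ∧
      Quadruple.IsImmersedSubmanifold d (Ω.uncertaintySet ρ l) := by
  refine ⟨hΩ.act_eq_self_iff hD, ?_, ?_, ?_, finrank_keySpace n m p, ?_⟩
  · rintro _ ⟨ψ, -, rfl⟩
    exact hΩ.toIsOptimal.act ψ
  · rintro _ ⟨ψ, hψ, rfl⟩
    -- For `Ω' = act ψ Ω` the identity serves as the second key.
    obtain ⟨φ, hP, hF, hG, hS⟩ := Quadruple.exists_iso_eq_one (n := n) (m := m) (p := p)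
    exact ⟨ψ, φ, hψ, Quadruple.messages_eq_of_act_eq
      (Quadruple.actRel_of_eq_one hP hF hG hS _).eq_act⟩
  · intro Ω₁ h₁ Ω₂ h₂
    obtain ⟨φ₁, hφ₁⟩ := Quadruple.exists_act_eq_of_mem_insert h₁
    obtain ⟨φ₂, hφ₂⟩ := Quadruple.exists_act_eq_of_mem_insert h₂
    exact ⟨φ₁, φ₂, Quadruple.messages_eq_of_act_eq (hφ₁.trans hφ₂.symm)⟩
  -- Any point of the group would do: the surjective derivative there gives `k ≤ dim 𝒢`, so the
  -- natural number subtraction below is exact.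
  · obtain ⟨ψ, -⟩ := hsurj 0
    have hk : k ≤ Module.finrank ℝ (KeySpace n m p) := by
      have h1 := LinearMap.finrank_le_finrank_of_surjective
        (f := (fderiv ℝ (extendIso ρ) ψ).toLinearMap)
        (surjective_fderiv_extendIso hρ ((hrank ψ).trans (by simp)))
      simpa using h1
    refine ⟨Module.finrank ℝ (KeySpace n m p) - k, ?_, ?_⟩
    · rw [Nat.sub_add_cancel hk, finrank_keySpace]
    · exact Quadruple.isImmersedSubmanifold_uncertaintySet hΩ.toIsOptimal hD hρ hrank l
        (Nat.sub_add_cancel hk)
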